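/- Let $d\ge 1$, let $X_1,X_2,\dots$ be i.i.d. $\mathbb{Z}^d$-valued random variables (with an arbitrary common law), let $S_0\in\mathbb{Z}^d$ be a constant and $S_k=S_0+\sum_{i=1}^k X_i$. Let $\mathcal N(a)$ denote the set of the $2d$ nearest neighbours of $a\in\mathbb{Z}^d$, that is, of the points at Euclidean distance $1$ from $a$. For $n\ge 0$ let $$H_n=\{S_i:\ 0\le i\le n,\ \{S_m\}_{m=0}^n\not\supset\mathcal N(S_i)\}$$ be the inner boundary of the range $\{S_m\}_{m=0}^n$ and, for an integer $p\ge 1$, let $$J_n^{(p)}=\sharp\{x\in H_n:\ \sharp\{m:0\le m\le n,\ S_m=x\}=p\},\qquad J_n^{p}=\sharp\{x\in H_n:\ \sharp\{m:0\le m\le n,\ S_m=x\}\ge p\}.$$ Let $\widetilde S,S^1,\dots,S^{p-1}$ and $S'$ be independent processes, where $\widetilde S,S^1,\dots,S^{p-1}$ are copies of the walk $(S_m-S_0)_{m\ge 0}$ started from $0$, and the dual walk $S'$ is a copy of $(-(S_m-S_0))_{m\ge 0}$. Put $T_{0,i}=\inf\{m\ge 1: S^i_m=0\}$, with $\inf\emptyset=\infty$.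 Then, almost surely, $$\lim_{n\to\infty}\frac{J_n^{(p)}}{n}=P\Big(\{\widetilde S_m\}_{m\ge0}\cup\{S'_m\}_{m\ge0}\cup\bigcup_{i=1}^{p-1}\{S^i_m\}_{0\le m\le T_{0,i}}\not\supset\mathcal N(0),\ 0\notin\{\widetilde S_m\}_{m\ge1}\cup\{S'_m\}_{m\ge1},\ 0\in\{S^i_m\}_{m\ge1}\text{ for }i=1,\dots,p-1\Big)$$ and, almost surely, $$\lim_{n\to\infty}\frac{J_n^{p}}{n}=P\Big(\{\widetilde S_m\}_{m\ge0}\cup\{S'_m\}_{m\ge0}\cup\bigcup_{i=1}^{p-1}\{S^i_m\}_{0\le m\le T_{0,i}}\not\supset\mathcal N(0),\ 0\notin\{\widetilde S_m\}_{m\ge1},\ 0\in\{S^i_m\}_{m\ge1}\text{ for }i=1,\dots,p-1\Big).$$ -/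

import Mathlib

open MeasureTheory ProbabilityTheory Filter Topology

/-- The integer lattice `ℤ^d`. -/
abbrev IntLattice (d : ℕ) : Type := Fin d → ℤ

/-- A trajectory `s 0, s 1, s 2, …` in `ℤ^d`. -/
abbrev Trajectory (d : ℕ) : Type := ℕ → IntLattice d

/-- The `2d` nearest neighbours of `a`. The distance is written out as the `ℓ¹` distance, because
the `dist` that Mathlib puts on `Fin d → ℤ` is the supremum distance; on the lattice, the points at
`ℓ¹` distance one are the points at Euclidean distance one. -/
def neighbors {d : ℕ} (a : IntLattice d) : Set (IntLattice d) :=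
  {z | ∑ j, |z j - a j| = 1}

/-- The walk `S_k = a + X_1 + ⋯ + X_k` started from `a`; the step `X_{i+1}` is `X i`. -/
def randomWalk {d : ℕ} {Ω : Type*} (a : IntLattice d) (X : ℕ → Ω → IntLattice d) (ω : Ω) :
    Trajectory d :=
  fun k => a + ∑ i ∈ Finset.range k, X i ω

/-- The inner boundary of the range `{s 0, …, s n}`: the visited points with at least one
neighbour that has not been visited. -/
def innerBoundary {d : ℕ} (s : Trajectory d) (n : ℕ) : Set (IntLattice d) :=
  {x | x ∈ s '' Set.Iic n ∧ ¬ neighbors x ⊆ s '' Set.Iic n}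

/-- The number of visits of `s 0, …, s n` to `x`. -/
noncomputable def visits {d : ℕ} (s : Trajectory d) (n : ℕ) (x : IntLattice d) : ℕ :=
  {m : ℕ | m ≤ n ∧ s m = x}.ncard

/-- The number of inner boundary points visited exactly `p` times in the first `n` steps. -/
noncomputable def countExactly {d : ℕ} (s : Trajectory d) (p n : ℕ) : ℕ :=
  {x | x ∈ innerBoundary s n ∧ visits s n x = p}.ncard

/-- The number of inner boundary points visited at least `p` times in the first `n` steps. -/
noncomputable def countAtLeast {d : ℕ} (s : Trajectory d) (p n : ℕ) : ℕ :=
  {x | x ∈ innerBoundary s n ∧ p ≤ visits s n x}.ncard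

/-- The passage time `inf {m ≥ 1 : s m = a}`, which is `⊤` if there is no such `m`. -/
noncomputable def passageTime {d : ℕ} (s : Trajectory d) (a : IntLattice d) : ℕ∞ :=
  sInf ((fun m : ℕ => (m : ℕ∞)) '' {m : ℕ | 1 ≤ m ∧ s m = a})

/-- The points `s 0, …, s T`, where `T` is the passage time to the origin. -/
def excursionRange {d : ℕ} (s : Trajectory d) : Set (IntLattice d) :=
  s '' {m : ℕ | (m : ℕ∞) ≤ passageTime s 0}

/-- The set `{s 1, s 2, …}`. -/
def futureRange {d : ℕ} (s : Trajectory d) : Set (IntLattice d) :=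
  s '' Set.Ici 1

/-- The whole of the forward walk `s`, the dual walk `s'` and the excursions `e i` does not
cover the neighbours of the origin. -/
def NotCovered {d k : ℕ} (s s' : Trajectory d) (e : Fin k → Trajectory d) : Prop :=
  ¬ neighbors (0 : IntLattice d) ⊆ Set.range s ∪ Set.range s' ∪ ⋃ i, excursionRange (e i)

/-- The event whose probability is the limit for points visited exactly `k + 1` times. -/
def exactEvent (d k : ℕ) : Set (Trajectory d × Trajectory d × (Fin k → Trajectory d)) :=
  {w | NotCovered w.1 w.2.1 w.2.2 ∧
    (0 : IntLattice d) ∉ futureRange w.1 ∪ futureRange w.2.1 ∧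
    ∀ i, (0 : IntLattice d) ∈ futureRange (w.2.2 i)}

/-- The event whose probability is the limit for points visited at least `k + 1` times. -/
def atLeastEvent (d k : ℕ) : Set (Trajectory d × Trajectory d × (Fin k → Trajectory d)) :=
  {w | NotCovered w.1 w.2.1 w.2.2 ∧
    (0 : IntLattice d) ∉ futureRange w.1 ∧
    ∀ i, (0 : IntLattice d) ∈ futureRange (w.2.2 i)}

/-- The law on trajectory space of the walk started from the origin. -/
noncomputable def walkLaw {d : ℕ} {Ω : Type*} [MeasurableSpace Ω] (P : Measure Ω)
    (X : ℕ → Ω → IntLattice d) : Measure (Trajectory d) :=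
  P.map (fun ω => randomWalk 0 X ω)

/-- The law on trajectory space of the dual walk, the negative of the walk from the origin. -/
noncomputable def dualLaw {d : ℕ} {Ω : Type*} [MeasurableSpace Ω] (P : Measure Ω)
    (X : ℕ → Ω → IntLattice d) : Measure (Trajectory d) :=
  P.map (fun ω => -randomWalk 0 X ω)

/-- The joint law of independent copies of the walk `S`, of the dual walk `S'` and of `k` further
walks `S^1, …, S^k`, all started from the origin. -/
noncomputable def jointLaw {d : ℕ} {Ω : Type*} [MeasurableSpace Ω] (P : Measure Ω)
    (X : ℕ → Ω → IntLattice d) (k : ℕ) :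
    Measure (Trajectory d × Trajectory d × (Fin k → Trajectory d)) :=
  (walkLaw P X).prod ((dualLaw P X).prod (Measure.pi fun _ : Fin k => walkLaw P X))

/-!
Write `k = p - 1`. A point of the inner boundary with `V ≥ k + 1` visits up to time `n` is counted
at the time `i` of its visit number `V - k`. Seen from its position at this time, the walk returns
exactly `k` times in its future, up to time `n - i`, and `V - k - 1` times in its past, up to time
`i`; the case `V = k + 1` is the one of no return in the past. So the count up to time `n` is the
sum over `i ≤ n` of the indicators of events that depend on the future up to `n - i` and on the
past up to `i`, evaluated along the orbit of the shift of a two-sided sequence of steps. As `n - i`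
and `i` tend to infinity, these indicators converge pointwise, because the origin has finitely many
neighbours. The shift is ergodic, so Maker's extension of Birkhoff's theorem gives the almost sure
limit of the averages: the probability that the two-sided walk has exactly `k` returns in its
future, has an admissible number of returns in its past and does not cover the neighbours of the
origin. The past is an independent dual walk. By the strong Markov property at the successive
returns, the future is made of `k` independent excursions followed by an independent walk that
does not return.
-/

section Birkhoff

variable {α : Type*}

/-- The maximal Birkhoff sum `max (0, g x, …, g x + ⋯ + g (T^(n-1) x))` of maximal ergodic
theory. -/
def maxBirkhoffSum (T : α → α) (g : α → ℝ) (n : ℕ) (x : α) : ℝ :=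
  partialSups (birkhoffSum T g · x) n

lemma maxBirkhoffSum_zero (T : α → α) (g : α → ℝ) : maxBirkhoffSum T g 0 = 0 := by
  ext x
  simp [maxBirkhoffSum]

lemma maxBirkhoffSum_succ (T : α → α) (g : α → ℝ) (n : ℕ) (x : α) :
    maxBirkhoffSum T g (n + 1) x = max 0 (g x + maxBirkhoffSum T g n (T x)) := by
  simp only [maxBirkhoffSum, partialSups_add_one', Function.comp_def, birkhoffSum_succ',
    partialSups_const_add]
  simp

lemma monotone_maxBirkhoffSum (T : α → α) (g : α → ℝ) (x : α) :
    Monotone (maxBirkhoffSum T g · x) :=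
  partialSups_monotone _

lemma birkhoffSum_le_maxBirkhoffSum (T : α → α) (g : α → ℝ) (n : ℕ) (x : α) :
    birkhoffSum T g n x ≤ maxBirkhoffSum T g n x :=
  le_partialSups (birkhoffSum T g · x) n

lemma maxBirkhoffSum_nonneg (T : α → α) (g : α → ℝ) (n : ℕ) (x : α) :
    0 ≤ maxBirkhoffSum T g n x :=
  le_partialSups_of_le (birkhoffSum T g · x) n.zero_le

lemma abs_maxBirkhoffSum_succ_sub_le (T : α → α) (g : α → ℝ) (n : ℕ) (x : α) :
    |maxBirkhoffSum T g (n + 1) x - maxBirkhoffSum T g n (T x)| ≤ |g x| := by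
  have h := abs_max_sub_max_le_abs (g x + maxBirkhoffSum T g n (T x)) (maxBirkhoffSum T g n (T x)) 0
  rwa [max_eq_left (maxBirkhoffSum_nonneg T g n (T x)), add_sub_cancel_right, max_comm,
    ← maxBirkhoffSum_succ] at h

lemma tendsto_maxBirkhoffSum_succ_sub (T : α → α) (g : α → ℝ) {x : α}
    (hx : ¬ BddAbove (Set.range (birkhoffSum T g · (T x)))) :
    Tendsto (fun n => maxBirkhoffSum T g (n + 1) x - maxBirkhoffSum T g n (T x)) atTop
      (𝓝 (g x)) := by
  obtain ⟨_, ⟨N, rfl⟩, hN⟩ := not_bddAbove_iff.1 hx (-g x)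
  refine tendsto_const_nhds.congr' ?_
  filter_upwards [eventually_ge_atTop N] with n hn
  have hle := (birkhoffSum_le_maxBirkhoffSum T g N (T x)).trans
    (monotone_maxBirkhoffSum T g (T x) hn)
  rw [maxBirkhoffSum_succ, max_eq_right (by linarith), add_sub_cancel_right]

lemma bddAbove_range_birkhoffSum_apply (T : α → α) (g : α → ℝ) (x : α) :
    BddAbove (Set.range (birkhoffSum T g · (T x))) ↔
      BddAbove (Set.range (birkhoffSum T g · x)) := by
  simp only [bddAbove_def, Set.forall_mem_range]
  constructor <;> rintro ⟨K, hK⟩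
  · refine ⟨max 0 (g x + K), fun n => ?_⟩
    cases n with
    | zero => simp
    | succ n =>
      rw [birkhoffSum_succ']
      exact le_max_of_le_right (by gcongr; exact hK n)
  · refine ⟨K - g x, fun n => ?_⟩
    have := hK (n + 1)
    rw [birkhoffSum_succ'] at this
    linarith

variable [MeasurableSpace α] {μ : Measure α} {T : α → α} {g : α → ℝ}

lemma integrable_birkhoffSum (hT : MeasurePreserving T μ μ) (hg : Integrable g μ) (n : ℕ) :
    Integrable (birkhoffSum T g n) μ :=
  integrable_finsetSum _ fun i _ => (hT.iterate i).integrable_comp_of_integrable hg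

lemma integrable_maxBirkhoffSum (hT : MeasurePreserving T μ μ) (hg : Integrable g μ) (n : ℕ) :
    Integrable (maxBirkhoffSum T g n) μ := by
  induction n with
  | zero => simp [maxBirkhoffSum_zero]
  | succ n ih =>
    rw [funext (maxBirkhoffSum_succ T g n)]
    exact (integrable_zero _ _ _).sup (hg.add (hT.integrable_comp_of_integrable ih))

lemma integral_maxBirkhoffSum_succ_sub_nonneg (hT : MeasurePreserving T μ μ)
    (hg : Integrable g μ) (n : ℕ) :
    0 ≤ ∫ x, (maxBirkhoffSum T g (n + 1) x - maxBirkhoffSum T g n (T x)) ∂μ := by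
  have hint := integrable_maxBirkhoffSum hT hg
  have hcomp : ∫ x, maxBirkhoffSum T g n (T x) ∂μ = ∫ x, maxBirkhoffSum T g n x ∂μ := by
    rw [← integral_map hT.aemeasurable (by rw [hT.map_eq]; exact (hint n).1), hT.map_eq]
  have hint' : Integrable (fun x => maxBirkhoffSum T g n (T x)) μ :=
    hT.integrable_comp_of_integrable (hint n)
  rw [integral_sub (hint _) hint', hcomp, sub_nonneg]
  exact integral_mono (hint n) (hint _) fun x => monotone_maxBirkhoffSum T g x n.le_succ

lemma integral_nonneg_of_ae_not_bddAbove (hT : MeasurePreserving T μ μ) (hg : Integrable g μ)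
    (h : ∀ᵐ x ∂μ, ¬ BddAbove (Set.range (birkhoffSum T g · x))) : 0 ≤ ∫ x, g x ∂μ := by
  have hint := integrable_maxBirkhoffSum hT hg
  refine ge_of_tendsto' (tendsto_integral_of_dominated_convergence (fun x => |g x|)
    (fun n => ((hint (n + 1)).sub (hT.integrable_comp_of_integrable (hint n))).1) hg.abs
    (fun n => .of_forall fun x => abs_maxBirkhoffSum_succ_sub_le T g n x) ?_)
    (integral_maxBirkhoffSum_succ_sub_nonneg hT hg)
  filter_upwards [h] with x hx
  exact tendsto_maxBirkhoffSum_succ_sub T g ((bddAbove_range_birkhoffSum_apply T g x).not.2 hx)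

lemma ae_bddAbove_range_birkhoffSum (hT : Ergodic T μ) (hg : Integrable g μ)
    (hneg : ∫ x, g x ∂μ < 0) : ∀ᵐ x ∂μ, BddAbove (Set.range (birkhoffSum T g · x)) := by
  set U := {x | BddAbove (Set.range (birkhoffSum T g · x))}
  have hU : NullMeasurableSet U μ := by
    have : U = ⋃ K : ℕ, ⋂ n, {x | birkhoffSum T g n x ≤ K} := by
      ext x
      simp only [U, bddAbove_def, Set.forall_mem_range, Set.mem_ofPred_eq, Set.mem_iUnion,
        Set.mem_iInter]
      exact ⟨fun ⟨y, hy⟩ => (exists_nat_ge y).imp fun K hK n => (hy n).trans hK,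
        fun ⟨K, hK⟩ => ⟨K, hK⟩⟩
    rw [this]
    exact .iUnion fun K => .iInter fun n => nullMeasurableSet_le
      (integrable_birkhoffSum hT.toMeasurePreserving hg n).1.aemeasurable aemeasurable_const
  refine (hT.quasiErgodic.ae_mem_or_ae_notMem₀ hU (ae_of_all _ fun x => propext
    (bddAbove_range_birkhoffSum_apply T g x))).resolve_right fun h => ?_
  exact hneg.not_ge (integral_nonneg_of_ae_not_bddAbove hT.toMeasurePreserving hg h)

variable [IsProbabilityMeasure μ]

lemma ae_eventually_birkhoffAverage_lt (hT : Ergodic T μ) (hg : Integrable g μ) {c : ℝ}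
    (hc : ∫ x, g x ∂μ < c) : ∀ᵐ x ∂μ, ∀ᶠ n in atTop, birkhoffAverage ℝ T g n x < c := by
  obtain ⟨b, hb, hbc⟩ := exists_between hc
  have hneg : ∫ x, (g x - b) ∂μ < 0 := by
    rw [integral_sub hg (integrable_const b)]
    simpa using hb
  filter_upwards [ae_bddAbove_range_birkhoffSum hT (hg.sub (integrable_const b)) hneg]
    with x ⟨K, hK⟩
  have hlim : Tendsto (fun n : ℕ => b + K / n) atTop (𝓝 (b + 0)) :=
    (tendsto_const_div_atTop_nhds_zero_nat K).const_add b
  filter_upwards [hlim.eventually_lt_const (by simpa using hbc), eventually_gt_atTop 0]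
    with n hn hn0
  have hsum : birkhoffSum T g n x - n * b ≤ K := by
    simpa [birkhoffSum, Finset.sum_sub_distrib] using hK ⟨n, rfl⟩
  refine lt_of_le_of_lt ?_ hn
  rw [birkhoffAverage, smul_eq_mul, inv_mul_le_iff₀ (by positivity)]
  field_simp
  linarith

/-- **Birkhoff's pointwise ergodic theorem** for an ergodic map. -/
theorem ae_tendsto_birkhoffAverage (hT : Ergodic T μ) (hg : Integrable g μ) :
    ∀ᵐ x ∂μ, Tendsto (birkhoffAverage ℝ T g · x) atTop (𝓝 (∫ x, g x ∂μ)) := by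
  have hupper {f : α → ℝ} (hf : Integrable f μ) : ∀ᵐ x ∂μ, ∀ q : ℚ, ∫ x, f x ∂μ < q →
      ∀ᶠ n in atTop, birkhoffAverage ℝ T f n x < q :=
    ae_all_iff.2 fun q => eventually_imp_distrib_left.2 fun hq =>
      ae_eventually_birkhoffAverage_lt hT hf hq
  filter_upwards [hupper hg, hupper hg.neg] with x hx hx'
  refine tendsto_order.2 ⟨fun a ha => ?_, fun a ha => ?_⟩
  · obtain ⟨q, haq, hq⟩ := exists_rat_btwn ha
    filter_upwards [hx' (-q) (by simpa [integral_neg] using hq)] with n hn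
    rw [birkhoffAverage_neg, Pi.neg_apply, Pi.neg_apply, Rat.cast_neg, neg_lt_neg_iff] at hn
    exact haq.trans hn
  · obtain ⟨q, hq, hqa⟩ := exists_rat_btwn ha
    filter_upwards [hx q hq] with n hn
    exact hn.trans hqa

lemma ae_tendsto_birkhoffSum_succ_div (hT : Ergodic T μ) (hg : Integrable g μ) :
    ∀ᵐ x ∂μ, Tendsto (fun n : ℕ => birkhoffSum T g (n + 1) x / n) atTop (𝓝 (∫ x, g x ∂μ)) := by
  filter_upwards [ae_tendsto_birkhoffAverage hT hg] with x hx
  convert (hx.comp (tendsto_add_atTop_nat 1)).div (tendsto_natCast_div_add_atTop (1 : ℝ))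
    one_ne_zero using 2 with n
  · simp only [birkhoffAverage, Function.comp_apply, smul_eq_mul, Pi.div_apply]
    push_cast
    field_simp
  · rw [div_one]

end Birkhoff

section Maker

open Finset.HasAntidiagonal (antidiagonal)

variable {α : Type*} {f : ℕ × ℕ → α → ℝ} {g : α → ℝ} {C : ℝ}

/-- The largest distance between `g x` and the functions `f q x` with both indices at least `k`.
Its values are junk where these distances are unbounded. -/
noncomputable def tailOscillation (f : ℕ × ℕ → α → ℝ) (g : α → ℝ) (k : ℕ) (x : α) : ℝ :=
  ⨆ q : Set.Ici (k, k), |f q x - g x|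

lemma tailOscillation_nonneg (f : ℕ × ℕ → α → ℝ) (g : α → ℝ) (k : ℕ) (x : α) :
    0 ≤ tailOscillation f g k x :=
  Real.iSup_nonneg fun _ => abs_nonneg _

lemma tailOscillation_le {k : ℕ} {x : α} (h : ∀ q ≥ (k, k), |f q x - g x| ≤ C) :
    tailOscillation f g k x ≤ C :=
  haveI : Nonempty (Set.Ici (k, k)) := ⟨⟨(k, k), Set.self_mem_Ici⟩⟩
  ciSup_le fun q => h q q.2

lemma abs_sub_le_tailOscillation {x : α} (h : ∀ q, |f q x - g x| ≤ C) {k : ℕ} {q : ℕ × ℕ}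
    (hq : (k, k) ≤ q) : |f q x - g x| ≤ tailOscillation f g k x :=
  le_ciSup (f := fun q : Set.Ici (k, k) => |f q x - g x|)
    ⟨C, Set.forall_mem_range.2 fun q => h q⟩ ⟨q, hq⟩

lemma tendsto_tailOscillation {x : α} (h : Tendsto (f · x) atTop (𝓝 (g x))) :
    Tendsto (tailOscillation f g · x) atTop (𝓝 0) := by
  refine tendsto_order.2 ⟨fun a ha => .of_forall fun k =>
    ha.trans_le (tailOscillation_nonneg f g k x), fun ε hε => ?_⟩
  obtain ⟨⟨u, v⟩, huv⟩ := eventually_atTop.1 (Metric.tendsto_nhds.1 h (ε / 2) (half_pos hε))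
  filter_upwards [eventually_ge_atTop (max u v)] with k hk
  refine lt_of_le_of_lt (tailOscillation_le fun q hq => ?_) (half_lt_self hε)
  rw [← Real.dist_eq]
  exact (huv q (le_trans ⟨(le_max_left u v).trans hk, (le_max_right u v).trans hk⟩ hq)).le

lemma abs_sum_antidiagonal_sub_birkhoffSum_le (T : α → α) (hC : 0 ≤ C)
    (hf : ∀ q x, |f q x - g x| ≤ C) (k n : ℕ) (x : α) :
    |∑ q ∈ antidiagonal n, f q (T^[q.2] x) - birkhoffSum T g (n + 1) x| ≤
      birkhoffSum T (tailOscillation f g k) (n + 1) x + 2 * (k * C) := by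
  have hterm (q : ℕ × ℕ) : |f q (T^[q.2] x) - g (T^[q.2] x)| ≤
      tailOscillation f g k (T^[q.2] x) +
        ((if q.1 < k then C else 0) + if q.2 < k then C else 0) := by
    have hnn := tailOscillation_nonneg f g k (T^[q.2] x)
    have hq := hf q (T^[q.2] x)
    by_cases h : (k, k) ≤ q
    · exact (abs_sub_le_tailOscillation (fun q => hf q _) h).trans
        (le_add_of_nonneg_right (by positivity))
    · rw [Prod.le_def, not_and_or, not_le, not_le] at h
      rcases h with h | h <;> rw [if_pos h] <;> split_ifs <;> linarith
  have hfst (φ : ℕ → ℝ) : ∑ q ∈ antidiagonal n, φ q.1 = ∑ i ∈ Finset.range (n + 1), φ i := by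
    rw [Finset.Nat.antidiagonal_eq_map, Finset.sum_map]
    rfl
  have hsnd (φ : ℕ → ℝ) : ∑ q ∈ antidiagonal n, φ q.2 = ∑ i ∈ Finset.range (n + 1), φ i := by
    rw [Finset.Nat.antidiagonal_eq_map', Finset.sum_map]
    rfl
  have hcard : ∑ i ∈ Finset.range (n + 1), (if i < k then C else 0) ≤ k * C := by
    rw [← Finset.sum_filter, Finset.sum_const, nsmul_eq_mul]
    gcongr
    refine (Finset.card_le_card fun i hi => ?_).trans_eq (Finset.card_range k)
    exact Finset.mem_range.2 (Finset.mem_filter.1 hi).2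
  calc
    _ = |∑ q ∈ antidiagonal n, (f q (T^[q.2] x) - g (T^[q.2] x))| := by
      rw [Finset.sum_sub_distrib, hsnd fun i => g (T^[i] x), birkhoffSum]
    _ ≤ ∑ q ∈ antidiagonal n, |f q (T^[q.2] x) - g (T^[q.2] x)| := Finset.abs_sum_le_sum_abs _ _
    _ ≤ _ := Finset.sum_le_sum fun q _ => hterm q
    _ ≤ _ := by
      rw [Finset.sum_add_distrib, Finset.sum_add_distrib,
        hsnd fun i => tailOscillation f g k (T^[i] x), hfst fun i => if i < k then C else 0,
        hsnd fun i => if i < k then C else 0, birkhoffSum]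
      linarith

variable [MeasurableSpace α] {μ : Measure α}

lemma measurable_tailOscillation (hfm : ∀ q, Measurable (f q)) (hgm : Measurable g) (k : ℕ) :
    Measurable (tailOscillation f g k) :=
  Measurable.iSup fun q : Set.Ici (k, k) => ((hfm q).sub hgm).abs

lemma integrable_tailOscillation [IsFiniteMeasure μ] (hfm : ∀ q, Measurable (f q))
    (hgm : Measurable g) (hfg : ∀ q x, |f q x - g x| ≤ C) (k : ℕ) :
    Integrable (tailOscillation f g k) μ := by
  refine .of_bound (measurable_tailOscillation hfm hgm k).aestronglyMeasurable C
    (ae_of_all _ fun x => ?_)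
  rw [Real.norm_of_nonneg (tailOscillation_nonneg f g k x)]
  exact tailOscillation_le fun q _ => hfg q x

lemma tendsto_integral_tailOscillation [IsFiniteMeasure μ] (hfm : ∀ q, Measurable (f q))
    (hgm : Measurable g) (hfg : ∀ q x, |f q x - g x| ≤ C)
    (hlim : ∀ x, Tendsto (f · x) atTop (𝓝 (g x))) :
    Tendsto (fun k => ∫ x, tailOscillation f g k x ∂μ) atTop (𝓝 0) := by
  have h := tendsto_integral_of_dominated_convergence (μ := μ) (fun _ => C)
    (F := tailOscillation f g) (f := 0) (fun k => ?_) (integrable_const C)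
    (fun k => ae_of_all _ fun x => ?_) (ae_of_all _ fun x => tendsto_tailOscillation (hlim x))
  · simpa using h
  · exact (measurable_tailOscillation hfm hgm k).aestronglyMeasurable
  · rw [Real.norm_of_nonneg (tailOscillation_nonneg f g k x)]
    exact tailOscillation_le fun q _ => hfg q x

/-- A two-parameter form of **Maker's ergodic theorem**: in the Birkhoff sums, the function may
vary with the times elapsed and remaining, as long as it converges when both are large. -/
theorem ae_tendsto_sum_antidiagonal_div [IsProbabilityMeasure μ] {T : α → α} (hT : Ergodic T μ)
    (hfm : ∀ q, Measurable (f q)) (hf : ∀ q x, |f q x| ≤ C)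
    (hlim : ∀ x, Tendsto (f · x) atTop (𝓝 (g x))) :
    ∀ᵐ x ∂μ, Tendsto (fun n : ℕ => (∑ q ∈ antidiagonal n, f q (T^[q.2] x)) / n) atTop
      (𝓝 (∫ x, g x ∂μ)) := by
  have hgm : Measurable g := measurable_of_tendsto_metrizable' atTop hfm (tendsto_pi_nhds.2 hlim)
  have hg (x : α) : |g x| ≤ C := le_of_tendsto' (hlim x).abs fun q => hf q x
  have hfg (q : ℕ × ℕ) (x : α) : |f q x - g x| ≤ C + C :=
    (abs_sub _ _).trans (add_le_add (hf q x) (hg x))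
  obtain ⟨x₀⟩ : Nonempty α := nonempty_of_isProbabilityMeasure μ
  have hC : 0 ≤ C + C := (abs_nonneg _).trans (hfg 0 x₀)
  have hgi : Integrable g μ := .of_bound hgm.aestronglyMeasurable C (ae_of_all _ hg)
  filter_upwards [ae_tendsto_birkhoffSum_succ_div hT hgi, ae_all_iff.2 fun k =>
    ae_tendsto_birkhoffSum_succ_div hT (integrable_tailOscillation hfm hgm hfg k)] with x hx hxt
  refine tendsto_of_tendsto_of_dist hx (tendsto_order.2 ⟨fun a ha =>
    .of_forall fun n => ha.trans_le dist_nonneg, fun ε hε => ?_⟩)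
  obtain ⟨k, hk⟩ :=
    ((tendsto_integral_tailOscillation (μ := μ) hfm hgm hfg hlim).eventually_lt_const hε).exists
  have hbound := (hxt k).add (tendsto_const_div_atTop_nhds_zero_nat (2 * (k * (C + C))))
  filter_upwards [hbound.eventually_lt_const (by simpa using hk)] with n hn
  refine lt_of_le_of_lt ?_ hn
  rw [dist_comm, Real.dist_eq, ← sub_div, ← add_div, abs_div, Nat.abs_cast]
  gcongr
  exact abs_sum_antidiagonal_sub_birkhoffSum_le T hC hfg k n x

end Maker

section Ergodic

variable {α : Type*} [mα : MeasurableSpace α] {μ : Measure α} [IsProbabilityMeasure μ] {T : α → α}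

lemma abs_measureReal_sq_sub_le (hT : MeasurePreserving T μ μ) {A C : Set α}
    (hA : MeasurableSet A) (hTA : T ⁻¹' A = A) (hC : MeasurableSet C) {n : ℕ}
    (hn : μ.real (C ∩ T^[n] ⁻¹' C) = μ.real C ^ 2) :
    |μ.real A ^ 2 - μ.real A| ≤ 4 * μ.real (symmDiff C A) := by
  have hTnA : T^[n] ⁻¹' A = A := by
    rw [Set.preimage_iterate_eq]
    exact Function.iterate_fixed hTA n
  have hpre : μ.real (T^[n] ⁻¹' symmDiff C A) = μ.real (symmDiff C A) :=
    (hT.iterate n).measureReal_preimage (hC.symmDiff hA).nullMeasurableSet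
  have hsub : symmDiff (C ∩ T^[n] ⁻¹' C) A ⊆ symmDiff C A ∪ T^[n] ⁻¹' symmDiff C A := by
    have hmem (x : α) : T^[n] x ∈ A ↔ x ∈ A := Set.ext_iff.1 hTnA x
    intro x
    simp only [Set.mem_symmDiff, Set.mem_union, Set.mem_preimage, Set.mem_inter_iff, hmem]
    tauto
  have hinter := (abs_measureReal_sub_le_measureReal_symmDiff (μ := μ)
    (hC.inter ((hT.iterate n).measurable hC)).nullMeasurableSet hA.nullMeasurableSet).trans
    ((measureReal_mono hsub).trans (measureReal_union_le _ _))
  have hclose := abs_measureReal_sub_le_measureReal_symmDiff (μ := μ) hC.nullMeasurableSet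
    hA.nullMeasurableSet
  have hsq : |μ.real A ^ 2 - μ.real C ^ 2| ≤ 2 * μ.real (symmDiff C A) := by
    rw [sq_sub_sq, abs_mul, abs_sub_comm (μ.real A)]
    have hA1 := measureReal_le_one (μ := μ) (s := A)
    have hC1 := measureReal_le_one (μ := μ) (s := C)
    gcongr
    rw [abs_of_nonneg (by positivity)]
    linarith
  rw [hn, hpre] at hinter
  exact (abs_sub_le _ (μ.real C ^ 2) _).trans (by linarith)

/-- An invariant set `A` is approximated by sets of the ring, which gives `μ A = μ A ^ 2`. -/
theorem ergodic_of_generateFrom_isSetRing (hT : MeasurePreserving T μ μ) {𝒞 : Set (Set α)}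
    (h𝒞 : IsSetRing 𝒞) (huniv : Set.univ ∈ 𝒞) (hgen : mα = MeasurableSpace.generateFrom 𝒞)
    (hmix : ∀ C ∈ 𝒞, ∃ n, μ.real (C ∩ T^[n] ⁻¹' C) = μ.real C ^ 2) : Ergodic T μ := by
  refine ⟨hT, ⟨fun A hA hTA => ?_⟩⟩
  have hsq : μ.real A ^ 2 - μ.real A = 0 := by
    refine abs_nonpos_iff.1 (le_of_forall_pos_le_add fun ε hε => ?_)
    obtain ⟨C, hC, hCA⟩ := exists_measure_symmDiff_lt_of_generateFrom_isSetRing (μ := μ) h𝒞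
      ⟨{Set.univ}, Set.countable_singleton _, by simpa using huniv, by simp⟩ hgen hA
      (ENNReal.ofReal_pos.2 (show 0 < ε / 4 by positivity))
    have hCm : MeasurableSet C := hgen ▸ MeasurableSpace.measurableSet_generateFrom hC
    obtain ⟨n, hn⟩ := hmix C hC
    have hlt : μ.real (symmDiff C A) < ε / 4 := ENNReal.toReal_lt_of_lt_ofReal hCA
    linarith [abs_measureReal_sq_sub_le hT hA hTA hCm hn]
  have h01 : μ.real A * (μ.real A - 1) = 0 := by linear_combination hsq
  rw [eventuallyConst_set', ae_eq_empty, ae_eq_univ, prob_compl_eq_zero_iff hA]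
  refine (mul_eq_zero.1 h01).imp (measureReal_eq_zero_iff).1 fun h => ?_
  rw [← ENNReal.toReal_eq_one_iff]
  exact sub_eq_zero.1 h

end Ergodic

section Shift

variable {E ι : Type*}

lemma iterate_comp_right (σ : ι → ι) (n : ℕ) (ω : ι → E) :
    (fun ω : ι → E => ω ∘ σ)^[n] ω = ω ∘ σ^[n] := by
  induction n with
  | zero => rfl
  | succ n ih => rw [Function.iterate_succ_apply', ih, Function.iterate_succ, Function.comp_assoc]

/-- The shift of two-sided sequences. -/
def intShift (ω : ℤ → E) : ℤ → E := ω ∘ (· + 1)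

lemma intShift_iterate (n : ℕ) (ω : ℤ → E) (i : ℤ) : intShift^[n] ω i = ω (i + n) := by
  unfold intShift
  rw [iterate_comp_right, add_right_iterate, nsmul_one, Function.comp_apply]

end Shift

section Product

variable {E : Type*} [MeasurableSpace E] (μ : Measure E) [IsProbabilityMeasure μ] {ι κ α β : Type*}

lemma measurePreserving_comp_infinitePi {f : ι → κ} (hf : Function.Injective f) :
    MeasurePreserving (fun ω : κ → E => ω ∘ f) (Measure.infinitePi fun _ => μ)
      (Measure.infinitePi fun _ => μ) :=
  ⟨by fun_prop, Measure.map_infinitePi_infinitePi_of_inj (P := fun _ => μ) hf⟩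

lemma measurePreserving_sumElim_infinitePi :
    MeasurePreserving (fun q : (α → E) × (β → E) => Sum.elim q.1 q.2)
      ((Measure.infinitePi fun _ => μ).prod (Measure.infinitePi fun _ => μ))
      (Measure.infinitePi fun _ => μ) := by
  have hm : Measurable fun q : (α → E) × (β → E) => Sum.elim q.1 q.2 :=
    measurable_pi_lambda _ (Sum.rec (fun i => by simp only [Sum.elim_inl]; fun_prop)
      (fun i => by simp only [Sum.elim_inr]; fun_prop))
  refine ⟨hm, Measure.eq_infinitePi _ fun s t ht => ?_⟩
  have hpre : (fun q : (α → E) × (β → E) => Sum.elim q.1 q.2) ⁻¹' Set.pi s t =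
      Set.pi s.toLeft (fun i => t (.inl i)) ×ˢ Set.pi s.toRight (fun i => t (.inr i)) := by
    ext q
    simp [Set.mem_pi]
  rw [Measure.map_apply hm (.pi s.countable_toSet fun i _ => ht i), hpre, Measure.prod_prod,
    Measure.infinitePi_pi _ fun i _ => ht _, Measure.infinitePi_pi _ fun i _ => ht _,
    ← Finset.prod_sumElim, Finset.toLeft_disjSum_toRight]
  exact Finset.prod_congr rfl (Sum.rec (fun _ _ => rfl) fun _ _ => rfl)

/-- Far enough along the orbits of `σ`, the coordinates of a cylinder are moved off themselves. -/
lemma exists_measureReal_cylinder_inter_eq_sq {σ : ι → ι} (hσ : Function.Injective σ)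
    (hσ' : ∀ i j, ∀ᶠ n in atTop, σ^[n] i ≠ j) (s : Finset ι) {S : Set (s → E)}
    (hS : MeasurableSet S) :
    ∃ n : ℕ, (Measure.infinitePi fun _ => μ).real
        (cylinder s S ∩ (fun ω : ι → E => ω ∘ σ)^[n] ⁻¹' cylinder s S) =
      (Measure.infinitePi fun _ => μ).real (cylinder s S) ^ 2 := by
  obtain ⟨n, hn⟩ : ∃ n, ∀ i ∈ s, ∀ j ∈ s, σ^[n] i ≠ j :=
    ((s.eventually_all).2 fun i _ => (s.eventually_all).2 fun j _ => hσ' i j).exists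
  have hinj : Function.Injective (Sum.elim ((↑) : s → ι) (σ^[n] ∘ ((↑) : s → ι))) :=
    Subtype.val_injective.sumElim ((hσ.iterate n).comp Subtype.val_injective)
      fun i j h => hn j j.2 i i.2 h.symm
  have hval := measurePreserving_comp_infinitePi μ (Subtype.val_injective (p := (· ∈ s)))
  have hboth := measurePreserving_comp_infinitePi μ hinj
  have hglue := measurePreserving_sumElim_infinitePi (α := s) (β := s) μ
  set B : Set (s ⊕ s → E) := (fun ω => (ω ∘ .inl, ω ∘ .inr)) ⁻¹' S ×ˢ S
  have hB : MeasurableSet B :=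
    measurableSet_preimage (by fun_prop) (hS.prod hS)
  have hcyl : cylinder s S ∩ (fun ω : ι → E => ω ∘ σ)^[n] ⁻¹' cylinder s S =
      (fun ω : ι → E => ω ∘ Sum.elim (↑) (σ^[n] ∘ (↑))) ⁻¹' B := by
    ext ω
    rw [Set.mem_inter_iff, Set.mem_preimage, iterate_comp_right]
    rfl
  have hsplit : (fun q : (s → E) × (s → E) => Sum.elim q.1 q.2) ⁻¹' B = S ×ˢ S := rfl
  have hone : (Measure.infinitePi fun _ => μ).real (cylinder s S) =
      (Measure.infinitePi fun _ => μ).real S := hval.measureReal_preimage hS.nullMeasurableSet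
  refine ⟨n, ?_⟩
  rw [hcyl, hboth.measureReal_preimage hB.nullMeasurableSet,
    ← hglue.measureReal_preimage hB.nullMeasurableSet, hsplit, measureReal_prod_prod, hone, sq]

theorem ergodic_comp_infinitePi {σ : ι → ι} (hσ : Function.Injective σ)
    (hσ' : ∀ i j, ∀ᶠ n in atTop, σ^[n] i ≠ j) :
    Ergodic (fun ω : ι → E => ω ∘ σ) (Measure.infinitePi fun _ => μ) := by
  refine ergodic_of_generateFrom_isSetRing (measurePreserving_comp_infinitePi μ hσ)
    isSetRing_measurableCylinders (univ_mem_measurableCylinders _)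
    generateFrom_measurableCylinders.symm fun C hC => ?_
  obtain ⟨s, S, hS, rfl⟩ := (mem_measurableCylinders _).1 hC
  exact exists_measureReal_cylinder_inter_eq_sq μ hσ hσ' s hS

lemma ergodic_intShift : Ergodic intShift (Measure.infinitePi fun _ : ℤ => μ) := by
  refine ergodic_comp_infinitePi μ (add_left_injective 1) fun i j => ?_
  filter_upwards [eventually_gt_atTop (j - i).toNat] with n hn
  rw [add_right_iterate, nsmul_one]
  lia

end Product

section Returns

variable {d : ℕ}

/-- The number of returns of `s` to the origin at the times `1, …, u`. -/
def returns (s : Trajectory d) (u : ℕ) : ℕ := Nat.count (fun j => s (j + 1) = 0) u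

/-- The number of all returns of `s` to the origin, which is `⊤` if there are infinitely many. -/
noncomputable def totalReturns (s : Trajectory d) : ℕ∞ := ⨆ u, (returns s u : ℕ∞)

lemma returns_congr {s s' : Trajectory d} {u : ℕ} (h : Set.EqOn s s' (Set.Iic u)) :
    returns s u = returns s' u := by
  simp only [returns, Nat.count_eq_card_filter_range]
  refine congrArg _ (Finset.filter_congr fun j hj => ?_)
  rw [h (Finset.mem_range.1 hj)]

lemma monotone_coe_returns (s : Trajectory d) : Monotone fun u => (returns s u : ℕ∞) :=
  Nat.mono_cast.comp (Nat.count_monotone _)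

lemma tendsto_coe_returns (s : Trajectory d) :
    Tendsto (fun u => (returns s u : ℕ∞)) atTop (𝓝 (totalReturns s)) :=
  tendsto_atTop_iSup (monotone_coe_returns s)

lemma eventually_returns_eq_iff (s : Trajectory d) (k : ℕ) :
    ∀ᶠ u in atTop, (returns s u = k ↔ totalReturns s = k) := by
  by_cases h : totalReturns s = k
  · filter_upwards [(tendsto_coe_returns s).eventually_mem
      ((ENat.isOpen_singleton (ENat.natCast_ne_top k)).mem_nhds h)] with u hu
    exact iff_of_true (Nat.cast_injective hu) h
  · filter_upwards [(tendsto_coe_returns s).eventually_ne h] with u hu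
    exact iff_of_false (fun h' => hu (congrArg _ h')) h

lemma eventually_returns_le_iff (s : Trajectory d) (r : ℕ∞) :
    ∀ᶠ u in atTop, ((returns s u : ℕ∞) ≤ r ↔ totalReturns s ≤ r) := by
  by_cases h : totalReturns s ≤ r
  · exact .of_forall fun u => iff_of_true ((le_iSup _ u).trans h) h
  · filter_upwards [(tendsto_coe_returns s).eventually_const_lt (not_le.1 h)] with u hu
    exact iff_of_false hu.not_ge h

end Returns

section Windows

variable {d : ℕ}

lemma mem_neighbors_iff_sub {z a : IntLattice d} : z ∈ neighbors a ↔ z - a ∈ neighbors 0 := by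
  simp [neighbors]

lemma finite_neighbors (a : IntLattice d) : (neighbors a).Finite := by
  refine (isCompact_closedBall a 1).finite_of_discrete.subset fun z hz => ?_
  refine (dist_pi_le_iff zero_le_one).2 fun j => ?_
  rw [Int.dist_eq]
  have h : |z j - a j| ≤ 1 := (Finset.single_le_sum (f := fun j => |z j - a j|)
    (fun _ _ => abs_nonneg _) (Finset.mem_univ j)).trans_eq hz
  exact_mod_cast h

lemma eventually_subset_image_Iic_iff {A : Set (IntLattice d)} (hA : A.Finite)
    (w : Trajectory d × Trajectory d) :
    ∀ᶠ q : ℕ × ℕ in atTop, (A ⊆ w.1 '' Set.Iic q.1 ∪ w.2 '' Set.Iic q.2 ↔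
      A ⊆ Set.range w.1 ∪ Set.range w.2) := by
  have hpoint : ∀ z ∈ A, ∀ᶠ q : ℕ × ℕ in atTop, z ∈ Set.range w.1 ∪ Set.range w.2 →
      z ∈ w.1 '' Set.Iic q.1 ∪ w.2 '' Set.Iic q.2 := by
    intro z _
    simp only [eventually_imp_distrib_left]
    rintro (⟨m, rfl⟩ | ⟨m, rfl⟩)
    · filter_upwards [eventually_ge_atTop (m, 0)] with q hq using .inl ⟨m, hq.1, rfl⟩
    · filter_upwards [eventually_ge_atTop (0, m)] with q hq using .inr ⟨m, hq.2, rfl⟩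
  filter_upwards [hA.eventually_all.2 hpoint] with q hq
  exact ⟨fun h => h.trans (Set.union_subset_union (Set.image_subset_range _ _)
    (Set.image_subset_range _ _)), fun h z hz => hq z hz (h hz)⟩

/-- The pairs of a forward and a backward trajectory of which, seen until the times `q.1` and
`q.2`, the forward one returns `k` times and the backward one at most `r` times to the origin, and
which do not cover its neighbours. The bound `r` is `0` for points visited exactly `k + 1` times,
and `⊤` for points visited at least `k + 1` times. -/
def window (k : ℕ) (r : ℕ∞) (q : ℕ × ℕ) : Set (Trajectory d × Trajectory d) :=
  {w | returns w.1 q.1 = k ∧ returns w.2 q.2 ≤ r ∧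
    ¬ neighbors 0 ⊆ w.1 '' Set.Iic q.1 ∪ w.2 '' Set.Iic q.2}

/-- The limit of `window k r q` when both coordinates of `q` tend to infinity. -/
def limitWindow (d k : ℕ) (r : ℕ∞) : Set (Trajectory d × Trajectory d) :=
  {w | totalReturns w.1 = k ∧ totalReturns w.2 ≤ r ∧
    ¬ neighbors 0 ⊆ Set.range w.1 ∪ Set.range w.2}

lemma mem_window_congr {k : ℕ} {r : ℕ∞} {q : ℕ × ℕ} {s s₁ s₂ : Trajectory d}
    (h : Set.EqOn s₁ s₂ (Set.Iic q.2)) : (s, s₁) ∈ window k r q ↔ (s, s₂) ∈ window k r q := by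
  simp only [window, Set.mem_ofPred_eq, returns_congr h, h.image_eq]

lemma eventually_mem_window_iff (k : ℕ) (r : ℕ∞) (w : Trajectory d × Trajectory d) :
    ∀ᶠ q : ℕ × ℕ in atTop, (w ∈ window k r q ↔ w ∈ limitWindow d k r) := by
  have hfst : Tendsto Prod.fst (atTop : Filter (ℕ × ℕ)) atTop := by
    rw [← prod_atTop_atTop_eq]
    exact tendsto_fst
  have hsnd : Tendsto Prod.snd (atTop : Filter (ℕ × ℕ)) atTop := by
    rw [← prod_atTop_atTop_eq]
    exact tendsto_snd
  filter_upwards [hfst.eventually (eventually_returns_eq_iff w.1 k),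
    hsnd.eventually (eventually_returns_le_iff w.2 r),
    eventually_subset_image_Iic_iff (finite_neighbors 0) w] with q h₁ h₂ h₃
  exact and_congr h₁ (and_congr h₂ (not_congr h₃))

lemma measurable_trajectory_apply_eq (m : ℕ) (z : IntLattice d) :
    Measurable fun s : Trajectory d => s m = z :=
  measurableSet_setOfPred.1 (measurableSet_eq_fun (measurable_pi_apply m) measurable_const)

lemma measurable_mem_image (z : IntLattice d) (I : Set ℕ) :
    Measurable fun s : Trajectory d => z ∈ s '' I :=
  .exists fun m => measurable_const.and (measurable_trajectory_apply_eq m z)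

lemma measurable_mem_range (z : IntLattice d) :
    Measurable fun s : Trajectory d => z ∈ Set.range s :=
  .exists fun m => measurable_trajectory_apply_eq m z

lemma measurable_subset {α : Type*} [MeasurableSpace α] (A : Set (IntLattice d))
    {B : α → Set (IntLattice d)} (hB : ∀ z, Measurable fun x => z ∈ B x) :
    Measurable fun x => A ⊆ B x :=
  .forall fun z => measurable_const.imp (hB z)

lemma measurable_returns (u : ℕ) : Measurable fun s : Trajectory d => returns s u := by
  simp only [returns, Nat.count_eq_card_filter_range, Finset.card_filter]
  exact Finset.measurable_sum _ fun j _ => .ite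
    (measurableSet_setOfPred.2 (measurable_trajectory_apply_eq _ 0)) measurable_const
    measurable_const

instance : BorelSpace ℕ∞ := ⟨borel_eq_top_of_countable.symm⟩

lemma measurable_totalReturns : Measurable (totalReturns (d := d)) :=
  .iSup fun u => Measurable.of_discrete.comp (measurable_returns u)

lemma measurableSet_window (k : ℕ) (r : ℕ∞) (q : ℕ × ℕ) :
    MeasurableSet (window k r q : Set (Trajectory d × Trajectory d)) := by
  refine measurableSet_setOfPred.2 (.and ?_ (.and ?_ (measurable_subset _ fun z => .or ?_ ?_).not))
  · exact (Measurable.of_discrete (f := (· = k))).comp ((measurable_returns _).comp measurable_fst)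
  · exact (Measurable.of_discrete (f := fun i : ℕ => (i : ℕ∞) ≤ r)).comp
      ((measurable_returns _).comp measurable_snd)
  · exact (measurable_mem_image z _).comp measurable_fst
  · exact (measurable_mem_image z _).comp measurable_snd

lemma measurableSet_limitWindow (k : ℕ) (r : ℕ∞) : MeasurableSet (limitWindow d k r) := by
  refine measurableSet_setOfPred.2 (.and ?_ (.and ?_ (measurable_subset _ fun z => .or ?_ ?_).not))
  · exact (Measurable.of_discrete (f := (· = (k : ℕ∞)))).comp
      (measurable_totalReturns.comp measurable_fst)
  · exact (Measurable.of_discrete (f := (· ≤ r))).comp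
      (measurable_totalReturns.comp measurable_snd)
  · exact (measurable_mem_range z).comp measurable_fst
  · exact (measurable_mem_range z).comp measurable_snd

end Windows

section Counting

variable {d : ℕ}

/-- The inner boundary points of `s 0, …, s n` that are visited at least `k + 1` and at most
`k + 1 + r` times. -/
def boundaryPoints (s : Trajectory d) (k : ℕ) (r : ℕ∞) (n : ℕ) : Set (IntLattice d) :=
  {x | x ∈ innerBoundary s n ∧ k + 1 ≤ visits s n x ∧ (visits s n x : ℕ∞) ≤ k + 1 + r}

/-- The future and the past of the trajectory `s`, seen from its position at time `i`. The second
trajectory is meaningful only up to time `i`, because the subtraction of times is truncated. -/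
def seenFrom (s : Trajectory d) (i : ℕ) : Trajectory d × Trajectory d :=
  (fun m => s (i + m) - s i, fun m => s (i - m) - s i)

lemma visits_eq_count (s : Trajectory d) (n : ℕ) (x : IntLattice d) :
    visits s n x = Nat.count (s · = x) (n + 1) := by
  rw [Nat.count_eq_card_filter_range, visits, ← Set.ncard_coe_finset]
  congr 1
  ext m
  simp

lemma returns_seenFrom_fst (s : Trajectory d) (i u : ℕ) :
    returns (seenFrom s i).1 u = Nat.count (fun j => s (i + 1 + j) = s i) u := by
  simp only [returns, seenFrom, sub_eq_zero, add_assoc, add_comm 1]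

lemma returns_seenFrom_snd (s : Trajectory d) (i : ℕ) :
    returns (seenFrom s i).2 i = Nat.count (s · = s i) i := by
  simp only [returns, seenFrom, sub_eq_zero, Nat.count_eq_card_filter_range, Finset.card_filter]
  rw [← Finset.sum_range_reflect fun m => if s m = s i then 1 else 0]
  simp only [Nat.sub_sub, add_comm 1]

lemma visits_apply (s : Trajectory d) {i n : ℕ} (hi : i ≤ n) :
    visits s n (s i) =
      returns (seenFrom s i).2 i + 1 + returns (seenFrom s i).1 (n - i) := by
  rw [visits_eq_count, returns_seenFrom_fst, returns_seenFrom_snd,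
    show n + 1 = i + 1 + (n - i) by lia, Nat.count_add, Nat.count_succ, if_pos rfl]

lemma image_seenFrom (s : Trajectory d) {i n : ℕ} (hi : i ≤ n) :
    (seenFrom s i).1 '' Set.Iic (n - i) ∪ (seenFrom s i).2 '' Set.Iic i =
      (· - s i) '' (s '' Set.Iic n) := by
  refine Set.Subset.antisymm (Set.union_subset ?_ ?_) ?_
  · rintro _ ⟨m, hm : m ≤ n - i, rfl⟩
    exact ⟨_, ⟨i + m, show i + m ≤ n by lia, rfl⟩, rfl⟩
  · rintro _ ⟨m, -, rfl⟩
    exact ⟨_, ⟨i - m, show i - m ≤ n by lia, rfl⟩, rfl⟩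
  · rintro _ ⟨_, ⟨m, hm : m ≤ n, rfl⟩, rfl⟩
    rcases le_total i m with h | h
    · exact .inl ⟨m - i, show m - i ≤ n - i by lia, by simp only [seenFrom, Nat.add_sub_cancel' h]⟩
    · exact .inr ⟨i - m, Nat.sub_le i m, by simp only [seenFrom, Nat.sub_sub_self h]⟩

lemma neighbors_zero_subset_image_sub_iff {a : IntLattice d} {A : Set (IntLattice d)} :
    neighbors 0 ⊆ (· - a) '' A ↔ neighbors a ⊆ A := by
  have h : neighbors a = Equiv.subRight a ⁻¹' neighbors 0 := Set.ext fun _ => mem_neighbors_iff_sub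
  have himage := (Equiv.subRight a).preimage_subset (neighbors 0) (Equiv.subRight a '' A)
  rwa [Equiv.preimage_image, ← h, iff_comm] at himage

lemma seenFrom_mem_window_iff {s : Trajectory d} {k : ℕ} {r : ℕ∞} {i n : ℕ} (hi : i ≤ n) :
    seenFrom s i ∈ window k r (n - i, i) ↔ s i ∈ innerBoundary s n ∧
      visits s n (s i) = Nat.count (s · = s i) i + 1 + k ∧ (Nat.count (s · = s i) i : ℕ∞) ≤ r := by
  have hvisited : s i ∈ s '' Set.Iic n := ⟨i, hi, rfl⟩
  simp only [window, innerBoundary, Set.mem_ofPred_eq, image_seenFrom s hi,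
    neighbors_zero_subset_image_sub_iff, visits_apply s hi, returns_seenFrom_snd, hvisited,
    add_right_inj]
  tauto

/-- A point is counted at its visit number `V - k`, where `V` is the number of all its visits. -/
lemma image_setOf_seenFrom_mem_window (s : Trajectory d) (k : ℕ) (r : ℕ∞) (n : ℕ) :
    s '' {i | i ≤ n ∧ seenFrom s i ∈ window k r (n - i, i)} = boundaryPoints s k r n := by
  ext x
  constructor
  · rintro ⟨i, ⟨hin, hi⟩, rfl⟩
    obtain ⟨hbd, hv, hr⟩ := (seenFrom_mem_window_iff hin).1 hi
    refine ⟨hbd, by lia, ?_⟩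
    rw [hv]
    push_cast
    rw [add_assoc, add_comm, add_comm 1]
    gcongr
  · rintro ⟨hbd, hk, hr⟩
    set V := visits s n x
    have hlt : V - (k + 1) < Nat.count (s · = x) (n + 1) := by
      rw [← visits_eq_count]
      lia
    have hcard (hf : {m | s m = x}.Finite) : V - (k + 1) < hf.toFinset.card :=
      hlt.trans_le (Nat.count_le_card hf _)
    have hsi : s (Nat.nth (s · = x) (V - (k + 1))) = x := Nat.nth_mem _ hcard
    have hin : Nat.nth (s · = x) (V - (k + 1)) ≤ n :=
      Nat.lt_succ_iff.1 (Nat.nth_lt_of_lt_count hlt)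
    refine ⟨_, ⟨hin, (seenFrom_mem_window_iff hin).2 ?_⟩, hsi⟩
    rw [hsi, Nat.count_nth hcard]
    refine ⟨hbd, by lia, ?_⟩
    obtain ⟨m, hm⟩ := Nat.exists_eq_add_of_le hk
    rw [hm] at hr ⊢
    rw [Nat.add_sub_cancel_left]
    push_cast at hr
    exact (ENat.add_le_add_iff_left (by exact_mod_cast ENat.natCast_ne_top (k + 1))).1 hr

lemma injOn_setOf_seenFrom_mem_window (s : Trajectory d) (k : ℕ) (r : ℕ∞) (n : ℕ) :
    Set.InjOn s {i | i ≤ n ∧ seenFrom s i ∈ window k r (n - i, i)} := by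
  rintro i ⟨hin, hi⟩ j ⟨hjn, hj⟩ hij
  have hvi := ((seenFrom_mem_window_iff hin).1 hi).2.1
  have hvj := ((seenFrom_mem_window_iff hjn).1 hj).2.1
  rw [hij] at hvi
  exact Nat.count_injective (p := (s · = s j)) hij rfl (by lia)

open Finset.HasAntidiagonal (antidiagonal) in
lemma ncard_boundaryPoints_eq_sum (s : Trajectory d) (k : ℕ) (r : ℕ∞) (n : ℕ) :
    ((boundaryPoints s k r n).ncard : ℝ) =
      ∑ q ∈ antidiagonal n, (window k r q).indicator 1 (seenFrom s q.2) := by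
  classical
  have hset : {i | i ≤ n ∧ seenFrom s i ∈ window k r (n - i, i)} =
      ((Finset.range (n + 1)).filter fun i => seenFrom s i ∈ window k r (n - i, i) : Finset ℕ) := by
    ext i
    simp
  rw [← image_setOf_seenFrom_mem_window, (injOn_setOf_seenFrom_mem_window s k r n).ncard_image,
    hset, Set.ncard_coe_finset, Finset.Nat.antidiagonal_eq_map', Finset.sum_map, Finset.card_filter]
  simp only [Nat.cast_sum, Nat.cast_ite, Nat.cast_one, Nat.cast_zero, Set.indicator_apply,
    Pi.one_apply]
  rfl

lemma countExactly_eq_ncard_boundaryPoints (s : Trajectory d) (k n : ℕ) :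
    countExactly s (k + 1) n = (boundaryPoints s k 0 n).ncard := by
  simp only [countExactly, boundaryPoints, add_zero]
  norm_cast
  simp only [le_antisymm_iff, and_comm]

lemma countAtLeast_eq_ncard_boundaryPoints (s : Trajectory d) (k n : ℕ) :
    countAtLeast s (k + 1) n = (boundaryPoints s k ⊤ n).ncard := by
  simp [countAtLeast, boundaryPoints]

end Counting

section TwoSided

variable {d : ℕ}

/-- The walk from the origin with the given steps. -/
def stepWalk (ξ : ℕ → IntLattice d) : Trajectory d := fun m => ∑ j ∈ Finset.range m, ξ j

/-- The forward and the backward trajectory, from the origin, of a two-sided sequence of steps. -/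
def twoSidedWalk (ω : ℤ → IntLattice d) : Trajectory d × Trajectory d :=
  (stepWalk fun j => ω j, -stepWalk fun j => ω (Int.negSucc j))

lemma measurable_stepWalk : Measurable (stepWalk (d := d)) :=
  measurable_pi_lambda _ fun _ => Finset.measurable_sum _ fun j _ => measurable_pi_apply j

lemma measurable_twoSidedWalk : Measurable (twoSidedWalk (d := d)) := by
  refine (measurable_stepWalk.comp ?_).prodMk (measurable_stepWalk.comp ?_).neg <;> fun_prop

lemma seenFrom_const_add (a : IntLattice d) (s : Trajectory d) (i : ℕ) :
    seenFrom (fun m => a + s m) i = seenFrom s i := by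
  simp only [seenFrom, add_sub_add_left_eq_sub]

lemma twoSidedWalk_intShift_fst (ω : ℤ → IntLattice d) (i : ℕ) :
    (twoSidedWalk (intShift^[i] ω)).1 = (seenFrom (stepWalk fun j => ω j) i).1 := by
  ext1 m
  simp only [twoSidedWalk, seenFrom, stepWalk, intShift_iterate, Finset.sum_range_add,
    add_sub_cancel_left, Nat.cast_add, add_comm (i : ℤ)]

lemma eqOn_twoSidedWalk_intShift_snd (ω : ℤ → IntLattice d) (i : ℕ) :
    Set.EqOn (twoSidedWalk (intShift^[i] ω)).2 (seenFrom (stepWalk fun j => ω j) i).2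
      (Set.Iic i) := by
  intro m hm
  obtain ⟨l, rfl⟩ := Nat.exists_eq_add_of_le' hm
  simp only [twoSidedWalk, seenFrom, stepWalk, intShift_iterate, Finset.sum_range_add, Pi.neg_apply,
    Nat.add_sub_cancel, sub_add_cancel_left, neg_inj]
  rw [← Finset.sum_range_reflect]
  refine Finset.sum_congr rfl fun j hj => congrArg ω ?_
  rw [Finset.mem_range] at hj
  lia

lemma twoSidedWalk_intShift_mem_window_iff {ω : ℤ → IntLattice d} {k : ℕ} {r : ℕ∞} {q : ℕ × ℕ} :
    twoSidedWalk (intShift^[q.2] ω) ∈ window k r q ↔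
      seenFrom (stepWalk fun j => ω j) q.2 ∈ window k r q := by
  rw [← Prod.mk.eta (p := twoSidedWalk _), mem_window_congr (eqOn_twoSidedWalk_intShift_snd ω q.2),
    twoSidedWalk_intShift_fst]

end TwoSided

section FirstReturn

variable {d : ℕ}

lemma le_passageTime_iff {s : Trajectory d} {a : IntLattice d} {m : ℕ∞} :
    m ≤ passageTime s a ↔ ∀ j : ℕ, 1 ≤ j → s j = a → m ≤ j := by
  simp only [passageTime, le_sInf_iff, Set.forall_mem_image, Set.mem_ofPred_eq, and_imp]

lemma passageTime_spec {s : Trajectory d} {a : IntLattice d} {n : ℕ} (h : passageTime s a = n) :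
    1 ≤ n ∧ s n = a := by
  have hne : ((fun m : ℕ => (m : ℕ∞)) '' {m : ℕ | 1 ≤ m ∧ s m = a}).Nonempty :=
    Set.nonempty_iff_ne_empty.2 fun he => by simp [passageTime, he] at h
  obtain ⟨m, hm, hmn⟩ := csInf_mem hne
  rw [← Nat.cast_injective (hmn.trans h)]
  exact hm

lemma returns_eq_zero_iff {s : Trajectory d} {u : ℕ} :
    returns s u = 0 ↔ (u : ℕ∞) < passageTime s 0 := by
  rw [← ENat.add_one_le_iff (ENat.natCast_ne_top u), le_passageTime_iff, returns,
    Nat.count_iff_forall_not]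
  norm_cast
  exact ⟨fun h j hj hs => not_lt.1 fun hlt => h (j - 1) (by lia) (by rwa [Nat.sub_add_cancel hj]),
    fun h j hj hs => (h (j + 1) (by lia) hs).not_gt (by lia)⟩

lemma passageTime_eq_top_iff {s : Trajectory d} {a : IntLattice d} :
    passageTime s a = ⊤ ↔ a ∉ futureRange s := by
  rw [eq_top_iff, le_passageTime_iff]
  simp [futureRange]

lemma exists_passageTime_eq {s : Trajectory d} {a : IntLattice d} (h : a ∈ futureRange s) :
    ∃ n : ℕ, passageTime s a = n :=
  ENat.ne_top_iff_exists.1 (mt passageTime_eq_top_iff.1 (not_not_intro h)) |>.imp fun _ => Eq.symm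

lemma totalReturns_eq_zero_iff {s : Trajectory d} : totalReturns s = 0 ↔ 0 ∉ futureRange s := by
  rw [← passageTime_eq_top_iff, ← nonpos_iff_eq_zero, totalReturns, iSup_le_iff,
    ENat.eq_top_iff_forall_gt]
  simp only [nonpos_iff_eq_zero, Nat.cast_eq_zero, returns_eq_zero_iff]

/-- Passage times are stopping times. -/
lemma passageTime_eq_congr {s s' : Trajectory d} {a : IntLattice d} {m : ℕ∞}
    (h : ∀ j : ℕ, j ≤ m → s j = s' j) : passageTime s a = m ↔ passageTime s' a = m := by
  have himp {s s' : Trajectory d} (h : ∀ j : ℕ, j ≤ m → s j = s' j) (hs : passageTime s a = m) :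
      passageTime s' a = m := by
    refine le_antisymm ?_ (le_passageTime_iff.2 fun j hj hja => not_lt.1 fun hlt => ?_)
    · cases m with
      | top => exact le_top
      | coe n =>
        obtain ⟨hn, hsn⟩ := passageTime_spec hs
        exact sInf_le ⟨n, ⟨hn, h n le_rfl ▸ hsn⟩, rfl⟩
    · exact (le_passageTime_iff.1 hs.ge j hj ((h j hlt.le).trans hja)).not_gt hlt
  exact ⟨himp h, himp fun j hj => (h j hj).symm⟩

lemma measurable_passageTime (a : IntLattice d) :
    Measurable fun s : Trajectory d => passageTime s a := by
  refine measurable_of_Ici fun m => ?_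
  simp only [Set.preimage, Set.mem_Ici, le_passageTime_iff]
  exact measurableSet_setOfPred.2 (.forall fun j => measurable_const.imp
    ((measurable_trajectory_apply_eq j a).imp measurable_const))

/-- The trajectory that follows `w.1` up to the time `m` and then the increments of `w.2`. -/
def concatAt (m : ℕ∞) (w : Trajectory d × Trajectory d) : Trajectory d :=
  fun j => if (j : ℕ∞) ≤ m then w.1 j else w.1 m.toNat + w.2 (j - m.toNat)

/-- The trajectory that follows `w.1` up to its first return to the origin and then `w.2`. -/
noncomputable def concatAtReturn (w : Trajectory d × Trajectory d) : Trajectory d :=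
  concatAt (passageTime w.1 0) w

lemma passageTime_concatAt_eq_iff {m : ℕ∞} {w : Trajectory d × Trajectory d} {a : IntLattice d} :
    passageTime (concatAt m w) a = m ↔ passageTime w.1 a = m :=
  passageTime_eq_congr fun _ hj => if_pos hj

variable {w : Trajectory d × Trajectory d}

lemma passageTime_concatAtReturn : passageTime (concatAtReturn w) 0 = passageTime w.1 0 :=
  passageTime_concatAt_eq_iff.2 rfl

lemma concatAtReturn_apply_of_le {j : ℕ} (h : j ≤ passageTime w.1 0) :
    concatAtReturn w j = w.1 j := if_pos h

lemma concatAtReturn_add {n : ℕ} (hn : passageTime w.1 0 = n) (j : ℕ) :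
    concatAtReturn w (n + (j + 1)) = w.2 (j + 1) := by
  have hlt : ¬ ((n + (j + 1) : ℕ) : ℕ∞) ≤ n := by
    norm_cast
    lia
  rw [concatAtReturn, concatAt, hn, if_neg hlt, ENat.toNat_natCast, (passageTime_spec hn).2,
    zero_add, Nat.add_sub_cancel_left]

lemma returns_concatAtReturn_add {n : ℕ} (hn : passageTime w.1 0 = n) (u : ℕ) :
    returns (concatAtReturn w) (n + u) = returns w.2 u + 1 := by
  have hpass : passageTime (concatAtReturn w) 0 = n := passageTime_concatAtReturn.trans hn
  obtain ⟨hn1, hzero⟩ := passageTime_spec hpass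
  obtain ⟨m, rfl⟩ := Nat.exists_eq_add_of_le' hn1
  have hm : returns (concatAtReturn w) m = 0 := by
    rw [returns_eq_zero_iff, hpass]
    exact_mod_cast Nat.lt_succ_self m
  have hlast : returns (concatAtReturn w) (m + 1) = 1 := by
    rw [returns, Nat.count_succ, if_pos hzero, ← returns, hm]
  rw [returns, Nat.count_add, ← returns, hlast, add_comm, returns]
  simp only [add_assoc (m + 1), concatAtReturn_add hn]

lemma totalReturns_concatAtReturn (h : 0 ∈ futureRange w.1) :
    totalReturns (concatAtReturn w) = totalReturns w.2 + 1 := by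
  obtain ⟨n, hn⟩ := exists_passageTime_eq h
  rw [totalReturns, totalReturns, ENat.iSup_add,
    ← (monotone_coe_returns (concatAtReturn w)).iSup_nat_add n]
  simp only [add_comm _ n, returns_concatAtReturn_add hn, Nat.cast_add, Nat.cast_one]

lemma totalReturns_concatAtReturn_eq_succ_iff {k : ℕ} :
    totalReturns (concatAtReturn w) = (k + 1 : ℕ) ↔ 0 ∈ futureRange w.1 ∧ totalReturns w.2 = k := by
  by_cases h : 0 ∈ futureRange w.1
  · rw [totalReturns_concatAtReturn h, and_iff_right h, Nat.cast_succ]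
    exact ENat.add_left_injective_of_ne_top ENat.one_ne_top |>.eq_iff
  · refine iff_of_false (fun hk => ?_) fun hk => h hk.1
    rw [totalReturns_eq_zero_iff.2] at hk
    · exact (Nat.cast_ne_zero.2 k.succ_ne_zero).symm hk
    · rwa [← passageTime_eq_top_iff, passageTime_concatAtReturn, passageTime_eq_top_iff]

lemma range_concatAtReturn (h : 0 ∈ futureRange w.1) (h0 : w.2 0 = 0) :
    Set.range (concatAtReturn w) = Set.range w.2 ∪ excursionRange w.1 := by
  obtain ⟨n, hn⟩ := exists_passageTime_eq h
  refine Set.Subset.antisymm ?_ (Set.union_subset ?_ ?_)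
  · rintro _ ⟨j, rfl⟩
    by_cases hj : (j : ℕ∞) ≤ passageTime w.1 0
    · exact .inr ⟨j, hj, (concatAtReturn_apply_of_le hj).symm⟩
    · rw [hn, Nat.cast_le, not_le] at hj
      obtain ⟨l, rfl⟩ := Nat.exists_eq_add_of_lt hj
      exact .inl ⟨l + 1, (concatAtReturn_add hn l).symm⟩
  · rintro _ ⟨_ | l, rfl⟩
    · exact ⟨n, by rw [concatAtReturn_apply_of_le hn.ge, (passageTime_spec hn).2, h0]⟩
    · exact ⟨n + (l + 1), concatAtReturn_add hn l⟩
  · rintro _ ⟨j, hj, rfl⟩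
    exact ⟨j, concatAtReturn_apply_of_le hj⟩

end FirstReturn

section Laws

lemma measurePreserving_prod_left_comm {α β γ : Type*} [MeasurableSpace α] [MeasurableSpace β]
    [MeasurableSpace γ] (κ : Measure α) (ν : Measure β) (ρ : Measure γ) [SFinite κ] [SFinite ν]
    [SFinite ρ] : MeasurePreserving (fun x : α × β × γ => (x.2.1, x.1, x.2.2))
      (κ.prod (ν.prod ρ)) (ν.prod (κ.prod ρ)) :=
  (measurePreserving_prodAssoc ν κ ρ).comp <|
    (Measure.measurePreserving_swap.prod (.id ρ)).comp (measurePreserving_prodAssoc κ ν ρ).symm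

lemma measurePreserving_finCons {α : Type*} [MeasurableSpace α] (ν : Measure α) [SigmaFinite ν]
    (k : ℕ) : MeasurePreserving (fun x : α × (Fin k → α) => (Fin.cons x.1 x.2 : Fin (k + 1) → α))
      (ν.prod (Measure.pi fun _ => ν)) (Measure.pi fun _ => ν) := by
  convert (measurePreserving_piFinSuccAbove (fun _ : Fin (k + 1) => ν) 0).symm
  funext x
  simp [MeasurableEquiv.piFinSuccAbove, Fin.insertNthEquiv]

lemma tsum_measure_preimage_singleton_inter {α ι : Type*} [MeasurableSpace α] [MeasurableSpace ι]
    [MeasurableSingletonClass ι] [Countable ι] (κ : Measure α) {σ : α → ι} (hσ : Measurable σ)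
    (B : Set α) : ∑' i, κ (σ ⁻¹' {i} ∩ B) = κ B := by
  have h := tsum_measure_preimage_singleton (μ := κ.restrict B) (f := σ) Set.countable_univ
    fun i _ => hσ (measurableSet_singleton i)
  rw [tsum_univ fun i => κ.restrict B (σ ⁻¹' {i}), Set.preimage_univ,
    Measure.restrict_apply_univ] at h
  simpa only [Measure.restrict_apply (hσ (measurableSet_singleton _))] using h

lemma measurePreserving_apply_index {α β ι : Type*} [MeasurableSpace α] [MeasurableSpace β]
    [MeasurableSpace ι] [MeasurableSingletonClass ι] [Countable ι] {κ : Measure α} {ν : Measure β}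
    {f : ι → α → β} (hf : ∀ i, MeasurePreserving (f i) κ ν) {σ : α → ι} (hσ : Measurable σ)
    {τ : β → ι} (hτ : Measurable τ) (h : ∀ i x, τ (f i x) = i ↔ σ x = i) :
    MeasurePreserving (fun x => f (σ x) x) κ ν := by
  have hmeas : Measurable fun x => f (σ x) x :=
    (measurable_from_prod_countable_right (f := fun q : ι × α => f q.1 q.2)
      fun i => (hf i).measurable).comp (hσ.prodMk measurable_id)
  refine ⟨hmeas, Measure.ext fun B hB => ?_⟩
  have hpiece : ∀ i, κ (σ ⁻¹' {i} ∩ (fun x => f (σ x) x) ⁻¹' B) = ν (τ ⁻¹' {i} ∩ B) := by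
    intro i
    rw [← (hf i).measure_preimage ((hτ (measurableSet_singleton i)).inter hB).nullMeasurableSet]
    congr 1
    ext x
    simp only [Set.mem_inter_iff, Set.mem_preimage, Set.mem_singleton_iff, h]
    exact and_congr_right fun hx => by rw [hx]
  rw [Measure.map_apply hmeas hB, ← tsum_measure_preimage_singleton_inter κ hσ,
    tsum_congr hpiece, tsum_measure_preimage_singleton_inter ν hτ]

lemma prod_setOf_and_congr {α β γ : Type*} [MeasurableSpace α] [MeasurableSpace β]
    [MeasurableSpace γ] {κ : Measure α} {ν : Measure β} {ρ : Measure γ} [SFinite ν] [SFinite ρ]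
    {p : α → Prop} (hp : Measurable p) {A : α → Set β} {B : α → Set γ}
    (hA : Measurable fun w : α × β => w.2 ∈ A w.1)
    (hB : Measurable fun w : α × γ => w.2 ∈ B w.1) (h : ∀ x, p x → ν (A x) = ρ (B x)) :
    κ.prod ν {w | p w.1 ∧ w.2 ∈ A w.1} = κ.prod ρ {w | p w.1 ∧ w.2 ∈ B w.1} := by
  have hpA : MeasurableSet {w : α × β | p w.1 ∧ w.2 ∈ A w.1} :=
    measurableSet_setOfPred.2 ((hp.comp measurable_fst).and hA)
  have hpB : MeasurableSet {w : α × γ | p w.1 ∧ w.2 ∈ B w.1} :=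
    measurableSet_setOfPred.2 ((hp.comp measurable_fst).and hB)
  rw [Measure.prod_apply hpA, Measure.prod_apply hpB]
  refine lintegral_congr fun x => ?_
  by_cases hx : p x
  · simpa [Set.preimage, hx] using h x hx
  · simp [Set.preimage, hx]

variable {d : ℕ}

/-- The law of the walk from the origin with independent steps of law `μ`. -/
noncomputable def stepLaw (μ : Measure (IntLattice d)) : Measure (Trajectory d) :=
  (Measure.infinitePi fun _ : ℕ => μ).map stepWalk

lemma ae_stepLaw_apply_zero (μ : Measure (IntLattice d)) : ∀ᵐ s ∂stepLaw μ, s 0 = 0 := by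
  rw [stepLaw, ae_map_iff measurable_stepWalk.aemeasurable
    (measurableSet_setOfPred.2 (measurable_trajectory_apply_eq 0 0))]
  exact ae_of_all _ fun ξ => Finset.sum_range_zero ξ

lemma measurePreserving_stepWalk (μ : Measure (IntLattice d)) :
    MeasurePreserving stepWalk (Measure.infinitePi fun _ : ℕ => μ) (stepLaw μ) :=
  measurable_stepWalk.measurePreserving _

variable (μ : Measure (IntLattice d)) [IsProbabilityMeasure μ]

instance isProbabilityMeasure_stepLaw : IsProbabilityMeasure (stepLaw μ) :=
  Measure.isProbabilityMeasure_map measurable_stepWalk.aemeasurable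

lemma concatAt_stepWalk (m : ℕ∞) (q : (ℕ → IntLattice d) × (ℕ → IntLattice d)) :
    concatAt m (stepWalk q.1, stepWalk q.2) =
      stepWalk fun i => if (i : ℕ∞) < m then q.1 i else q.2 (i - m.toNat) := by
  have hfst : ∀ j : ℕ, j ≤ m →
      ∑ i ∈ Finset.range j, (if (i : ℕ∞) < m then q.1 i else q.2 (i - m.toNat)) =
        ∑ i ∈ Finset.range j, q.1 i := fun j hj => Finset.sum_congr rfl fun i hi =>
    if_pos ((Nat.cast_lt.2 (Finset.mem_range.1 hi)).trans_le hj)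
  funext j
  by_cases hj : (j : ℕ∞) ≤ m
  · simp only [concatAt, if_pos hj, stepWalk, hfst j hj]
  · obtain ⟨n, rfl⟩ := ENat.ne_top_iff_exists.1 (not_le.1 hj).ne_top
    obtain ⟨l, rfl⟩ := Nat.exists_eq_add_of_le (Nat.cast_lt.1 (not_le.1 hj)).le
    simp only [concatAt, if_neg hj, stepWalk, Finset.sum_range_add, hfst n le_rfl]
    simp [not_lt.2 le_self_add]

lemma measurable_concatAt (m : ℕ∞) : Measurable (concatAt (d := d) m) := by
  refine measurable_pi_lambda _ fun j => ?_
  by_cases hj : (j : ℕ∞) ≤ m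
  · simp only [concatAt, if_pos hj]
    fun_prop
  · simp only [concatAt, if_neg hj]
    fun_prop

/-- The Markov property. -/
lemma measurePreserving_concatAt (m : ℕ∞) :
    MeasurePreserving (concatAt m) ((stepLaw μ).prod (stepLaw μ)) (stepLaw μ) := by
  set f : ℕ → ℕ ⊕ ℕ := fun i => if (i : ℕ∞) < m then .inl i else .inr (i - m.toNat) with hf
  have hinj : Function.Injective f := by
    intro i j hij
    simp only [hf] at hij
    cases m with
    | top => simpa using hij
    | coe n =>
      simp only [Nat.cast_lt, ENat.toNat_natCast] at hij
      split_ifs at hij <;> simp at hij <;> lia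
  have h := (measurePreserving_stepWalk μ).comp <|
    (measurePreserving_comp_infinitePi μ hinj).comp (measurePreserving_sumElim_infinitePi μ)
  have hpair := (measurePreserving_stepWalk μ).prod (measurePreserving_stepWalk μ)
  rw [← hpair.map_eq]
  refine .map_of_comp ?_ (measurable_concatAt m) hpair.measurable
  convert h using 1
  funext q
  refine (concatAt_stepWalk m q).trans (congrArg stepWalk (funext fun i => ?_))
  simp only [Function.comp_apply, hf]
  split_ifs <;> rfl

/-- The strong Markov property. -/
lemma measurePreserving_concatAtReturn :
    MeasurePreserving concatAtReturn ((stepLaw μ).prod (stepLaw μ)) (stepLaw μ) :=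
  measurePreserving_apply_index (measurePreserving_concatAt μ)
    ((measurable_passageTime 0).comp measurable_fst) (measurable_passageTime 0)
    fun _ _ => passageTime_concatAt_eq_iff

end Laws

section Excursions

variable {d : ℕ}

/-- The trajectories with exactly `k` returns to the origin that do not cover its neighbours
together with `G`. -/
def returnsNotCovered (k : ℕ) (G : Set (IntLattice d)) : Set (Trajectory d) :=
  {s | totalReturns s = k ∧ ¬ neighbors 0 ⊆ Set.range s ∪ G}

/-- The pairs of a trajectory without return to the origin and `k` trajectories with such a return
of which the former and the excursions of the latter do not cover the neighbours of the origin
together with `G`. -/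
def excursionsNotCovered (k : ℕ) (G : Set (IntLattice d)) :
    Set (Trajectory d × (Fin k → Trajectory d)) :=
  {w | ¬ neighbors 0 ⊆ Set.range w.1 ∪ G ∪ ⋃ i, excursionRange (w.2 i) ∧
    0 ∉ futureRange w.1 ∧ ∀ i, 0 ∈ futureRange (w.2 i)}

lemma measurable_mem_futureRange (z : IntLattice d) :
    Measurable fun s : Trajectory d => z ∈ futureRange s :=
  measurable_mem_image z _

lemma measurable_mem_excursionRange (z : IntLattice d) :
    Measurable fun s : Trajectory d => z ∈ excursionRange s :=
  .exists fun m => ((Measurable.of_discrete (f := fun t : ℕ∞ => (m : ℕ∞) ≤ t)).comp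
    (measurable_passageTime 0)).and (measurable_trajectory_apply_eq m z)

variable {α : Type*} [MeasurableSpace α]

lemma measurable_mem_returnsNotCovered (k : ℕ) {f : α → Trajectory d} (hf : Measurable f)
    {G : α → Set (IntLattice d)} (hG : ∀ z, Measurable fun x => z ∈ G x) :
    Measurable fun x => f x ∈ returnsNotCovered k (G x) :=
  ((Measurable.of_discrete (f := (· = (k : ℕ∞)))).comp (measurable_totalReturns.comp hf)).and
    (measurable_subset _ fun z => ((measurable_mem_range z).comp hf).or (hG z)).not

lemma measurable_mem_excursionsNotCovered (k : ℕ)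
    {f : α → Trajectory d × (Fin k → Trajectory d)} (hf : Measurable f)
    {G : α → Set (IntLattice d)} (hG : ∀ z, Measurable fun x => z ∈ G x) :
    Measurable fun x => f x ∈ excursionsNotCovered k (G x) := by
  have hfst : Measurable fun x => (f x).1 := by fun_prop
  have hsnd (i : Fin k) : Measurable fun x => (f x).2 i := by fun_prop
  refine (measurable_subset _ fun z => .or (.or ?_ (hG z)) ?_).not.and (.and ?_ (.forall ?_))
  · exact (measurable_mem_range z).comp hfst
  · simp only [Set.mem_iUnion]
    exact .exists fun i => (measurable_mem_excursionRange z).comp (hsnd i)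
  · exact ((measurable_mem_futureRange 0).comp hfst).not
  · exact fun i => (measurable_mem_futureRange 0).comp (hsnd i)

lemma concatAtReturn_mem_returnsNotCovered_succ_iff {w : Trajectory d × Trajectory d}
    (h0 : w.2 0 = 0) {k : ℕ} {G : Set (IntLattice d)} :
    concatAtReturn w ∈ returnsNotCovered (k + 1) G ↔
      0 ∈ futureRange w.1 ∧ w.2 ∈ returnsNotCovered k (excursionRange w.1 ∪ G) := by
  rw [returnsNotCovered, Set.mem_ofPred_eq, totalReturns_concatAtReturn_eq_succ_iff, and_assoc]
  refine and_congr_right fun h => ?_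
  rw [range_concatAtReturn h h0, Set.union_assoc]
  rfl

lemma cons_mem_excursionsNotCovered_succ_iff {k : ℕ} {G : Set (IntLattice d)} {e s : Trajectory d}
    {w : Fin k → Trajectory d} :
    (s, (Fin.cons e w : Fin (k + 1) → Trajectory d)) ∈ excursionsNotCovered (k + 1) G ↔
      0 ∈ futureRange e ∧ (s, w) ∈ excursionsNotCovered k (excursionRange e ∪ G) := by
  have hunion : Set.range s ∪ G ∪ ⋃ i, excursionRange ((Fin.cons e w : Fin (k + 1) → _) i) =
      Set.range s ∪ (excursionRange e ∪ G) ∪ ⋃ i, excursionRange (w i) := by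
    ext z
    simp only [Set.mem_union, Set.mem_iUnion, Fin.exists_fin_succ, Fin.cons_zero, Fin.cons_succ]
    tauto
  simp only [excursionsNotCovered, Set.mem_ofPred_eq, hunion, Fin.forall_fin_succ, Fin.cons_zero,
    Fin.cons_succ]
  tauto

variable (μ : Measure (IntLattice d)) [IsProbabilityMeasure μ]

lemma stepLaw_returnsNotCovered_succ (k : ℕ) (G : Set (IntLattice d)) :
    stepLaw μ (returnsNotCovered (k + 1) G) = ((stepLaw μ).prod (stepLaw μ))
      {w | 0 ∈ futureRange w.1 ∧ w.2 ∈ returnsNotCovered k (excursionRange w.1 ∪ G)} := by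
  have hB : MeasurableSet (returnsNotCovered (k + 1) G) := measurableSet_setOfPred.2
    (measurable_mem_returnsNotCovered (k + 1) measurable_id fun _ => measurable_const)
  rw [← (measurePreserving_concatAtReturn μ).measure_preimage hB.nullMeasurableSet]
  refine measure_congr ?_
  filter_upwards [Measure.quasiMeasurePreserving_snd.ae (ae_stepLaw_apply_zero μ)] with w hw
  exact propext (concatAtReturn_mem_returnsNotCovered_succ_iff hw)

theorem stepLaw_returnsNotCovered (k : ℕ) (G : Set (IntLattice d)) :
    stepLaw μ (returnsNotCovered k G) =
      ((stepLaw μ).prod (Measure.pi fun _ : Fin k => stepLaw μ)) (excursionsNotCovered k G) := by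
  induction k generalizing G with
  | zero =>
    have hprod : excursionsNotCovered 0 G = returnsNotCovered 0 G ×ˢ Set.univ := by
      ext w
      simp [excursionsNotCovered, returnsNotCovered, totalReturns_eq_zero_iff, and_comm]
    rw [hprod, Measure.prod_prod, measure_univ, mul_one]
  | succ k ih =>
    have hcons := ((MeasurePreserving.id (stepLaw μ)).prod
      (measurePreserving_finCons (stepLaw μ) k)).comp
      (measurePreserving_prod_left_comm (stepLaw μ) (stepLaw μ) (Measure.pi fun _ => stepLaw μ))
    have hG (z : IntLattice d) : Measurable fun s => z ∈ excursionRange s ∪ G :=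
      (measurable_mem_excursionRange z).or measurable_const
    have hB : Measurable fun w : Trajectory d × Trajectory d =>
        w.2 ∈ returnsNotCovered k (excursionRange w.1 ∪ G) :=
      measurable_mem_returnsNotCovered k measurable_snd fun z => (hG z).comp measurable_fst
    have hC : MeasurableSet (excursionsNotCovered (k + 1) G) := measurableSet_setOfPred.2
      (measurable_mem_excursionsNotCovered (k + 1) measurable_id fun _ => measurable_const)
    have hD : Measurable fun w : Trajectory d × Trajectory d × (Fin k → Trajectory d) =>
        w.2 ∈ excursionsNotCovered k (excursionRange w.1 ∪ G) :=
      measurable_mem_excursionsNotCovered k measurable_snd fun z => (hG z).comp measurable_fst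
    rw [stepLaw_returnsNotCovered_succ, ← hcons.measure_preimage hC.nullMeasurableSet]
    refine (prod_setOf_and_congr (measurable_mem_futureRange 0) hB hD
      fun s _ => ih (excursionRange s ∪ G)).trans ?_
    congr 1
    ext w
    exact cons_mem_excursionsNotCovered_succ_iff.symm

lemma prod_limitWindow (ρ : Measure (Trajectory d)) [SFinite ρ] (k : ℕ) (r : ℕ∞) :
    ((stepLaw μ).prod ρ) (limitWindow d k r) =
      ((stepLaw μ).prod (ρ.prod (Measure.pi fun _ : Fin k => stepLaw μ)))
        {w | totalReturns w.2.1 ≤ r ∧ w ∈ atLeastEvent d k} := by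
  have hr : Measurable fun s : Trajectory d => totalReturns s ≤ r :=
    (Measurable.of_discrete (f := (· ≤ r))).comp measurable_totalReturns
  have hB : Measurable fun w : Trajectory d × Trajectory d =>
      w.2 ∈ returnsNotCovered k (Set.range w.1) :=
    measurable_mem_returnsNotCovered k measurable_snd fun z =>
      (measurable_mem_range z).comp measurable_fst
  have hD : Measurable fun w : Trajectory d × Trajectory d × (Fin k → Trajectory d) =>
      w.2 ∈ excursionsNotCovered k (Set.range w.1) :=
    measurable_mem_excursionsNotCovered k measurable_snd fun z =>
      (measurable_mem_range z).comp measurable_fst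
  have hswap := Measure.measurePreserving_swap (μ := ρ) (ν := stepLaw μ)
  have hcomm := measurePreserving_prod_left_comm (stepLaw μ) ρ
    (Measure.pi fun _ : Fin k => stepLaw μ)
  have hE : MeasurableSet {w : Trajectory d × Trajectory d × (Fin k → Trajectory d) |
      totalReturns w.1 ≤ r ∧ w.2 ∈ excursionsNotCovered k (Set.range w.1)} :=
    measurableSet_setOfPred.2 ((hr.comp measurable_fst).and hD)
  calc ((stepLaw μ).prod ρ) (limitWindow d k r)
      = (ρ.prod (stepLaw μ))
          {w | totalReturns w.1 ≤ r ∧ w.2 ∈ returnsNotCovered k (Set.range w.1)} := by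
        rw [← hswap.measure_preimage (measurableSet_limitWindow k r).nullMeasurableSet]
        congr 1
        ext w
        exact and_left_comm
    _ = (ρ.prod ((stepLaw μ).prod (Measure.pi fun _ : Fin k => stepLaw μ)))
          {w | totalReturns w.1 ≤ r ∧ w.2 ∈ excursionsNotCovered k (Set.range w.1)} :=
        prod_setOf_and_congr hr hB hD fun s _ => stepLaw_returnsNotCovered μ k _
    _ = ((stepLaw μ).prod (ρ.prod (Measure.pi fun _ : Fin k => stepLaw μ)))
          {w | totalReturns w.2.1 ≤ r ∧ w ∈ atLeastEvent d k} :=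
        (hcomm.measure_preimage hE.nullMeasurableSet).symm

end Excursions

section Limit

variable {d : ℕ}

section TwoSidedSteps

variable (μ : Measure (IntLattice d)) [IsProbabilityMeasure μ]

lemma measurePreserving_sumElim_intEquivNatSumNat :
    MeasurePreserving (fun q : (ℕ → IntLattice d) × (ℕ → IntLattice d) =>
        Sum.elim q.1 q.2 ∘ Equiv.intEquivNatSumNat)
      ((Measure.infinitePi fun _ => μ).prod (Measure.infinitePi fun _ => μ))
      (Measure.infinitePi fun _ => μ) :=
  (measurePreserving_comp_infinitePi μ Equiv.intEquivNatSumNat.injective).comp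
    (measurePreserving_sumElim_infinitePi μ)

lemma measurePreserving_twoSidedWalk :
    MeasurePreserving twoSidedWalk (Measure.infinitePi fun _ => μ)
      ((stepLaw μ).prod ((stepLaw μ).map Neg.neg)) := by
  have hneg : MeasurePreserving (Neg.neg : Trajectory d → Trajectory d) (stepLaw μ)
      ((stepLaw μ).map Neg.neg) := measurable_neg.measurePreserving _
  have hsteps := measurePreserving_sumElim_intEquivNatSumNat μ
  rw [← hsteps.map_eq]
  exact .map_of_comp ((measurePreserving_stepWalk μ).prod
    (hneg.comp (measurePreserving_stepWalk μ))) measurable_twoSidedWalk hsteps.measurable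

lemma ae_tendsto_ncard_boundaryPoints_stepWalk_int_div (k : ℕ) (r : ℕ∞) :
    ∀ᵐ ω ∂(Measure.infinitePi fun _ : ℤ => μ),
      Tendsto (fun n : ℕ => ((boundaryPoints (stepWalk fun j => ω j) k r n).ncard : ℝ) / n) atTop
        (𝓝 (((stepLaw μ).prod ((stepLaw μ).map Neg.neg)).real (limitWindow d k r))) := by
  set f : ℕ × ℕ → (ℤ → IntLattice d) → ℝ := fun q => (twoSidedWalk ⁻¹' window k r q).indicator 1
  have hmeas (q : ℕ × ℕ) : Measurable (f q) :=
    measurable_one.indicator (measurable_twoSidedWalk (measurableSet_window k r q))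
  have hbound (q : ℕ × ℕ) (ω : ℤ → IntLattice d) : |f q ω| ≤ 1 :=
    (norm_indicator_le_norm_self (1 : (ℤ → IntLattice d) → ℝ) ω).trans_eq norm_one
  have hlim (ω : ℤ → IntLattice d) : Tendsto (f · ω) atTop
      (𝓝 ((twoSidedWalk ⁻¹' limitWindow d k r).indicator 1 ω)) :=
    (tendsto_indicator_const_apply_iff_eventually atTop (1 : ℝ) ω).2
      (eventually_mem_window_iff k r (twoSidedWalk ω))
  have hbirkhoff := ae_tendsto_sum_antidiagonal_div (ergodic_intShift μ) hmeas hbound hlim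
  rw [integral_indicator_one (measurable_twoSidedWalk (measurableSet_limitWindow k r)),
    (measurePreserving_twoSidedWalk μ).measureReal_preimage
      (measurableSet_limitWindow k r).nullMeasurableSet] at hbirkhoff
  filter_upwards [hbirkhoff] with ω hω
  refine hω.congr fun n => ?_
  classical
  rw [ncard_boundaryPoints_eq_sum]
  simp only [f, Set.indicator_apply, Set.mem_preimage, twoSidedWalk_intShift_mem_window_iff,
    Pi.one_apply]

theorem ae_tendsto_ncard_boundaryPoints_stepWalk_div (k : ℕ) (r : ℕ∞) :
    ∀ᵐ ξ ∂(Measure.infinitePi fun _ : ℕ => μ),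
      Tendsto (fun n : ℕ => ((boundaryPoints (stepWalk ξ) k r n).ncard : ℝ) / n) atTop
        (𝓝 (((stepLaw μ).prod ((stepLaw μ).map Neg.neg)).real (limitWindow d k r))) := by
  have h := Measure.ae_ae_of_ae_prod <|
    (measurePreserving_sumElim_intEquivNatSumNat μ).quasiMeasurePreserving.ae
      (ae_tendsto_ncard_boundaryPoints_stepWalk_int_div μ k r)
  filter_upwards [h] with ξ hξ
  exact hξ.exists.choose_spec

end TwoSidedSteps

section Walk

lemma ncard_boundaryPoints_const_add (a : IntLattice d) (s : Trajectory d) (k : ℕ) (r : ℕ∞)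
    (n : ℕ) :
    (boundaryPoints (fun m => a + s m) k r n).ncard = (boundaryPoints s k r n).ncard := by
  rw [← Nat.cast_inj (R := ℝ)]
  simp only [ncard_boundaryPoints_eq_sum, seenFrom_const_add]

variable {Ω : Type*} {X : ℕ → Ω → IntLattice d}

lemma randomWalk_eq_const_add (a : IntLattice d) (ω : Ω) :
    randomWalk a X ω = fun m => a + stepWalk (fun i => X i ω) m := rfl

lemma randomWalk_zero (ω : Ω) : randomWalk 0 X ω = stepWalk fun i => X i ω := by
  simp only [randomWalk_eq_const_add, zero_add]

variable [MeasurableSpace Ω] {P : Measure Ω}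

lemma dualLaw_eq_map_neg_walkLaw (hmeas : ∀ i, Measurable (X i)) :
    dualLaw P X = (walkLaw P X).map Neg.neg := by
  simp only [walkLaw, dualLaw, randomWalk_zero]
  exact (Measure.map_map measurable_neg
    (measurable_stepWalk.comp (measurable_pi_lambda _ hmeas))).symm

variable [IsProbabilityMeasure P]

lemma measurePreserving_steps (hmeas : ∀ i, Measurable (X i)) (hindep : iIndepFun X P)
    (hident : ∀ i, IdentDistrib (X i) (X 0) P P) :
    MeasurePreserving (fun ω i => X i ω) P (Measure.infinitePi fun _ => P.map (X 0)) := by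
  have (i : ℕ) : IsProbabilityMeasure (P.map (X i)) :=
    Measure.isProbabilityMeasure_map (hmeas i).aemeasurable
  refine ⟨measurable_pi_lambda _ hmeas, ?_⟩
  rw [hindep.map_fun_eq_infinitePi_map hmeas]
  congr 1
  funext i
  exact (hident i).map_eq

lemma walkLaw_eq_stepLaw (hmeas : ∀ i, Measurable (X i)) (hindep : iIndepFun X P)
    (hident : ∀ i, IdentDistrib (X i) (X 0) P P) : walkLaw P X = stepLaw (P.map (X 0)) := by
  simp only [walkLaw, randomWalk_zero]
  exact ((measurePreserving_stepWalk _).comp (measurePreserving_steps hmeas hindep hident)).map_eq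

theorem ae_tendsto_ncard_boundaryPoints_div (hmeas : ∀ i, Measurable (X i))
    (hindep : iIndepFun X P) (hident : ∀ i, IdentDistrib (X i) (X 0) P P) (a : IntLattice d)
    (k : ℕ) (r : ℕ∞) :
    ∀ᵐ ω ∂P, Tendsto (fun n : ℕ => ((boundaryPoints (randomWalk a X ω) k r n).ncard : ℝ) / n) atTop
      (𝓝 ((jointLaw P X k).real {w | totalReturns w.2.1 ≤ r ∧ w ∈ atLeastEvent d k})) := by
  have := Measure.isProbabilityMeasure_map (μ := P) (hmeas 0).aemeasurable
  have h := ae_tendsto_ncard_boundaryPoints_stepWalk_div (P.map (X 0)) k r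
  rw [measureReal_def, prod_limitWindow, ← measureReal_def,
    ← walkLaw_eq_stepLaw hmeas hindep hident, ← dualLaw_eq_map_neg_walkLaw hmeas] at h
  simp only [randomWalk_eq_const_add, ncard_boundaryPoints_const_add]
  exact (measurePreserving_steps hmeas hindep hident).quasiMeasurePreserving.ae h

end Walk

lemma exactEvent_eq_setOf (d k : ℕ) :
    exactEvent d k = {w | totalReturns w.2.1 ≤ 0 ∧ w ∈ atLeastEvent d k} := by
  ext w
  simp only [exactEvent, atLeastEvent, Set.mem_ofPred_eq, Set.mem_union, not_or, nonpos_iff_eq_zero,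
    totalReturns_eq_zero_iff]
  tauto

end Limit

theorem theorem2 {d : ℕ} (hd : 1 ≤ d) {Ω : Type*} [MeasurableSpace Ω] (P : Measure Ω)
    [IsProbabilityMeasure P] (X : ℕ → Ω → IntLattice d) (hmeas : ∀ i, Measurable (X i))
    (hindep : iIndepFun X P) (hident : ∀ i, IdentDistrib (X i) (X 0) P P)
    (a : IntLattice d) (p : ℕ) (hp : 1 ≤ p) :
    (∀ᵐ ω ∂P, Tendsto (fun n : ℕ => (countExactly (randomWalk a X ω) p n : ℝ) / (n : ℝ)) atTop
      (𝓝 ((jointLaw P X (p - 1)).real (exactEvent d (p - 1))))) ∧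
    (∀ᵐ ω ∂P, Tendsto (fun n : ℕ => (countAtLeast (randomWalk a X ω) p n : ℝ) / (n : ℝ)) atTop
      (𝓝 ((jointLaw P X (p - 1)).real (atLeastEvent d (p - 1))))) := by
  obtain ⟨k, rfl⟩ := Nat.exists_eq_add_of_le' hp
  have hlim := ae_tendsto_ncard_boundaryPoints_div hmeas hindep hident a k
  rw [Nat.add_sub_cancel]
  constructor
  · simpa only [countExactly_eq_ncard_boundaryPoints, exactEvent_eq_setOf] using hlim 0
  · simpa only [countAtLeast_eq_ncard_boundaryPoints, le_top, true_and, Set.ofPred_mem_eq]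
      using hlim ⊤
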